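/- **Model spaces.** $X(n)$ denotes either $\mathrm{Sol}(n)$ ($n>0$ real), i.e. $\mathbb R^3$ with the Riemannian metric $dz^2+e^{-2nz}dx^2+e^{2nz}dy^2$, with branching constant $B_X=n$; or the Diestel–Leader graph $DL(n,n)$ ($n\ge 2$ an integer), i.e. the subset $f_1+f_2=0$ of the product of two $(n+1)$-valent trees with Busemann functions $f_1,f_2$, with edges of length one, height $h=f_1$ and $B_X=\log n$. The lower and upper boundaries $\partial_-X,\partial^+X$ are $\mathbb R$ for $\mathrm{Sol}(n)$ and the $n$-adic rationals $\mathbb Q_n$ for $DL(n,n)$; they carry Lebesgue, respectively Haar, measure $|\cdot|$ (a unit ball of $\mathbb Q_n$ has measure $1$). $(x,y,z)$ is the point at height $z$ on the vertical geodesic joining $x\in\partial_-X$ to $y\in\partial^+X$. Let $h^-(y,y')$ be the height at which the vertical geodesics leaving $y,y'\in\partial^+X$ are one unit apart ($-\frac1n\log|y-y'|$ in $\mathrm{Sol}(n)$), respectively meet ($DL$), with $h^-(y,y)=+\infty$; for $F\subset\partial^+X$ put $\mathcal C_z(F)=\{y:\exists y'\in F,\ h^-(y,y')>z\}$. A box $B(R)=S_X\times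 S_Y\times[h_{bot},h_{top}]$ of size $R$ is a left translate of $[-\tfrac{e^{2nR}}2,\tfrac{e^{2nR}}2]^2\times[-\tfrac R2,\tfrac R2]$ in $\mathrm{Sol}(n)$; in $DL(n,n)$, for $R$ an even integer, it is the connected component of a vertex $p$ in $h^{-1}([h(p)-\frac{R+1}2,h(p)+\frac{R+1}2])$. Volumes are taken in the coordinates $(x,y,z)$. The $y$-horocycle through $x_0$ at height $h_0$ is $H_0=\{(x_0,y,h_0):y\in\partial^+X\}$, and $\pi_-(H_0)\subset\partial_-X$ is the set of lower endpoints of the vertical rays going down that start within distance $\rho_1$ of $H_0$. **Setting.** Let $X=X(n)$ and $X'=X(n')$ be both of type $\mathrm{Sol}$ or both of type $DL$, with branching constants $B_X,B_X'$, and let $\kappa\ge1$, $C\ge0$, $K>0$. Let $\phi:X\to X'$ be a $(\kappa,C)$ quasi-isometry (coarsely surjective) whose restriction to a box $B(R)$ is an $(\epsilon,\theta)$-almost product map: there are measurable $E_1\subset S_X$, $E_2\subset S_Y$ of relative measure at least $1-\theta$ and maps $f:\partial_-X\to\partial_-X'$, $g:\partial^+X\to\partial^+X'$, $q:\mathbb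 R\to\mathbb R$ with $d(\phi(x,y,z),(f(x),g(y),q(z)))\le K\epsilon R$ for all $x\in E_1$, $y\in E_2$, $z\in[h_{bot},h_{top}]$. Let $U$ be the set of all these points $(x,y,z)$, and let $U_*\subset U$ be any measurable subset of relative measure at least $1-128\theta^{1/2}$. **Proposition.** Let $0<\beta\ll\beta'\ll\beta''\ll1$ (each less than a positive bound depending only on the ones to its right and on $\kappa,C,K,n,n'$). There are $\delta_0>0$ and functions $\epsilon'(\epsilon,\theta)$, $c(\epsilon,\theta)$, all depending only on these constants, with $\epsilon',c\to0$ as $\epsilon,\theta\to0^+$, such that for all $\epsilon,\theta\in(0,\delta_0)$, all $\rho_1>0$ and all $R\ge R_0$ (where $R_0$ depends on all of the constants above, $\epsilon$, $\theta$ and $\rho_1$), the following holds in the setting above. There is a nonempty $E_*\subset S_X$ with $|S_X\setminus E_*|\le c(\epsilon,\theta)|S_X|$ such that, for every $y$-horocycle $H_0$ through a point of $S_X$, at a height $h_0$ with $h_{top}-h_0>4\kappa^2\beta''R$ and $h_0-h_{bot}>4\kappa^2\beta''R$, for which $\pi_-(H_0)$ contains a point of $E_*$, the following is true for the set $$S=\{(x,y,z):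 x\in\pi_-(H_0),\ y\in S_Y,\ h_0-\beta''R<z<h_0\}\cap U_*,$$ and likewise with $h_0<z<h_0+\beta''R$ in place of $h_0-\beta''R<z<h_0$. Let $h_{bot}<z_{bot}<z_{top}<h_{top}$ with $4\beta R\le|z_{top}-z_{bot}|\le\beta'R$, $|h_{top}-z_{top}|>4\kappa^2\beta''R$ and $|z_{bot}-h_{bot}|>4\kappa^2\beta''R$. Then $0<|\mathcal C_{q(z_{bot})}(g(S_Y\cap S))|<\infty$ and for all $z\in[z_{bot},z_{top}]$ $$\left|\,q(z)-\left(Az-\frac1{B_X'}\log\frac{|\mathcal C_{q(z_{bot})}(g(S_Y\cap S))|}{|S_Y|}\right)\right|\le\epsilon'(\epsilon,\theta)\,R,\qquad A=\frac{B_X}{B_X'},$$ where $g(S_Y\cap S)$ is the image under $g$ of those points of $E_2$ that are $y$-coordinates of points of $S$. In particular $A=1$ if $n=n'$. -/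

import Mathlib

open Set Filter Topology MeasureTheory

noncomputable section

/-- The data attached to a model space `X(n)`: its points with their metric, its lower and upper
boundaries with their Haar measures, the point `pt x y z` at height `z` on the vertical geodesic
joining `x` to `y`, the height `hMinus` at which the vertical geodesics leaving two upper boundary
points come together, the branching number, and the boxes `S_X × S_Y × [h_bot, h_top]` of a given
size. Only the two concrete families
`solModel` and `dlModel` constructed below are ever used. -/
structure ModelSpace where
  Pt : Type
  dist : Pt → Pt → ℝ
  Lower : Type
  Upper : Type
  [measLower : MeasurableSpace Lower]
  [measUpper : MeasurableSpace Upper]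
  lowerMeasure : Measure Lower
  upperMeasure : Measure Upper
  pt : Lower → Upper → ℝ → Pt
  hMinus : Upper → Upper → EReal
  branching : ℝ
  IsBox : ℝ → Set Lower → Set Upper → ℝ → ℝ → Prop

attribute [instance] ModelSpace.measLower ModelSpace.measUpper

/-! ### The solvable groups -/

/-- The Riemannian distance of `Sol(n)`, that is of `dz² + e^{-2nz} dx² + e^{2nz} dy²` on `ℝ³`:
the infimum of the lengths of `C¹` curves joining the two points. -/
def solDist (n : ℝ) (p q : ℝ × ℝ × ℝ) : ℝ :=
  sInf {l : ℝ | ∃ x y z : ℝ → ℝ, ContDiff ℝ 1 x ∧ ContDiff ℝ 1 y ∧ ContDiff ℝ 1 z ∧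
    (x 0, y 0, z 0) = p ∧ (x 1, y 1, z 1) = q ∧
    l = ∫ t in (0 : ℝ)..1, Real.sqrt ((deriv z t) ^ 2 +
      Real.exp (-(2 * n * z t)) * (deriv x t) ^ 2 + Real.exp (2 * n * z t) * (deriv y t) ^ 2)}

/-- `Sol(n)`. The vertical geodesics over `y, y'` are `|y - y'| e^{nz}` apart at height `z`, so that
they are one unit apart at height `-log |y - y'| / n`.
A box of size `R` is the left translate by `(x₀, y₀, z₀)` of
`[-e^{2nR}/2, e^{2nR}/2]² × [-R/2, R/2]`. -/
def solModel (n : ℝ) : ModelSpace where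
  Pt := ℝ × ℝ × ℝ
  dist := solDist n
  Lower := ℝ
  Upper := ℝ
  lowerMeasure := volume
  upperMeasure := volume
  pt := fun x y z => (x, y, z)
  hMinus := fun y y' => if y = y' then ⊤ else ((-(Real.log |y - y'| / n) : ℝ) : EReal)
  branching := n
  IsBox := fun R SX SY hbot htop => ∃ x₀ y₀ z₀ : ℝ,
    SX = Icc (x₀ - Real.exp (n * z₀) * (Real.exp (2 * n * R) / 2))
      (x₀ + Real.exp (n * z₀) * (Real.exp (2 * n * R) / 2)) ∧
    SY = Icc (y₀ - Real.exp (-(n * z₀)) * (Real.exp (2 * n * R) / 2))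
      (y₀ + Real.exp (-(n * z₀)) * (Real.exp (2 * n * R) / 2)) ∧
    hbot = z₀ - R / 2 ∧ htop = z₀ + R / 2

/-! ### The Diestel-Leader graphs -/

/-- The `m`-adic rationals, that is bi-infinite strings of base `m` digits with finitely many nonzero
digits in nonnegative positions: the digits in positions `0, 1, 2, …` are those of a natural number,
the digits in positions `-1, -2, …` are arbitrary. (The larger the position, the coarser.) -/
abbrev Adic (m : ℕ) : Type := ℕ × (ℕ → Fin m)

/-- The digit of `x` in position `j`. -/
def Adic.digit {m : ℕ} (x : Adic m) (j : ℤ) : ℕ :=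
  if 0 ≤ j then x.1 / m ^ j.toNat % m else (x.2 (-j - 1).toNat : ℕ)

/-- `x` and `x'` have the same digits in all positions at least `k`. -/
def Adic.Agree {m : ℕ} (k : ℤ) (x x' : Adic m) : Prop :=
  ∀ j : ℤ, k ≤ j → x.digit j = x'.digit j

/-- The Haar measure, normalized so that the balls `{x | Agree 0 x x₀}` have measure `1`. -/
def adicMeasure (m : ℕ) : Measure (Adic m) :=
  Measure.count.prod (Measure.infinitePi fun _ : ℕ => ProbabilityTheory.uniformOn (univ : Set (Fin m)))

/-- The height at which the vertical geodesics of the tree leaving `x` and `x'` meet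
(`⊥` if `x = x'`). -/
def Adic.meet {m : ℕ} (x x' : Adic m) : EReal :=
  ⨅ (k : ℤ) (_ : Adic.Agree k x x'), ((k : ℝ) : EReal)

/-- The pairs `(x, s)` and `(x', s')` represent the same point of the tree if they have the same
height `s = s'` and the lines leaving `x` and `x'` have met at or below this height. -/
def treeSetoid (m : ℕ) : Setoid (Adic m × ℝ) where
  r a b := a.2 = b.2 ∧ Adic.Agree ⌊a.2⌋ a.1 b.1
  iseqv :=
    { refl := fun _ => ⟨rfl, fun _ _ => rfl⟩
      symm := fun {_ _} h => ⟨h.1.symm, fun j hj => (h.2 j (by rw [h.1]; exact hj)).symm⟩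
      trans := fun {_ _ _} h h' => ⟨h.1.trans h'.1,
        fun j hj => (h.2 j hj).trans (h'.2 j (by rw [← h.1]; exact hj))⟩ }

/-- The points (vertices and points of edges) of the regular tree of valence `m + 1` with a chosen
end: vertices sit at integer heights, each has one edge up, towards the chosen end, and `m` edges
down. The lines going up from the lower end `x` are `s ↦ (x, s)`. -/
def TreePt (m : ℕ) : Type := Quotient (treeSetoid m)

/-- The point at height `s` on the line of `x`. -/
def TreePt.mk {m : ℕ} (x : Adic m) (s : ℝ) : TreePt m := Quotient.mk (treeSetoid m) (x, s)

/-- The height (Busemann) function of the tree. -/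
def TreePt.height {m : ℕ} : TreePt m → ℝ :=
  Quotient.lift (fun a : Adic m × ℝ => a.2) (fun _ _ h => h.1)

/-- The Diestel-Leader graph `DL(m, m)` with its edges: the subset `f₁ + f₂ = 0` of the product of
two trees. -/
def DL (m : ℕ) : Type := {p : TreePt m × TreePt m // p.1.height + p.2.height = 0}

/-- The point at height `z` on the vertical geodesic joining `x` to `y`. -/
def DL.pt {m : ℕ} (x y : Adic m) (z : ℝ) : DL m :=
  ⟨(TreePt.mk x z, TreePt.mk y (-z)), add_neg_cancel z⟩

/-- `DL.PathLength p q l`: there is a path of length `l` from `p` to `q` that is a concatenation of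
finitely many vertical segments. -/
inductive DL.PathLength {m : ℕ} : DL m → DL m → ℝ → Prop
  | nil (p : DL m) : DL.PathLength p p 0
  | cons (x y : Adic m) (s t : ℝ) (q : DL m) (l : ℝ) :
      DL.PathLength (DL.pt x y t) q l → DL.PathLength (DL.pt x y s) q (|s - t| + l)

/-- The metric of the graph, with edges of length one. -/
def DL.dist {m : ℕ} (p q : DL m) : ℝ := sInf {l : ℝ | DL.PathLength p q l}

/-- `DL(m, m)`. A box of even size `R = 2l` centred at the vertex `pt x₀ y₀ k` is the connected
component of the centre in the set of points with heights in
`[k - (R + 1) / 2, k + (R + 1) / 2]`: it consists of the points on vertical geodesics whose two tree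
components stay below the tree points over the centre at the top and at the bottom. -/
def dlModel (m : ℕ) : ModelSpace where
  Pt := DL m
  dist := DL.dist
  Lower := Adic m
  Upper := Adic m
  lowerMeasure := adicMeasure m
  upperMeasure := adicMeasure m
  pt := DL.pt
  hMinus := fun y y' => -Adic.meet y y'
  branching := Real.log m
  IsBox := fun R SX SY hbot htop => ∃ (x₀ y₀ : Adic m) (k : ℤ) (l : ℕ), R = 2 * (l : ℝ) ∧
    hbot = (k : ℝ) - (R + 1) / 2 ∧ htop = (k : ℝ) + (R + 1) / 2 ∧
    SX = {x | TreePt.mk x htop = TreePt.mk x₀ htop} ∧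
    SY = {y | TreePt.mk y (-hbot) = TreePt.mk y₀ (-hbot)}

/-- The pairs `(X(n), X(n'))` of model spaces: both solvable groups or both Diestel-Leader graphs. -/
inductive ModelPair : ModelSpace → ModelSpace → Prop
  | sol (n n' : ℝ) (hn : 0 < n) (hn' : 0 < n') : ModelPair (solModel n) (solModel n')
  | dl (m m' : ℕ) (hm : 2 ≤ m) (hm' : 2 ≤ m') : ModelPair (dlModel m) (dlModel m')

namespace ModelSpace

variable (X X' : ModelSpace)

/-- `(κ, C)` quasi-isometries. -/
def IsQuasiIsometry (κ C : ℝ) (φ : X.Pt → X'.Pt) : Prop :=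
  (∀ p p', κ⁻¹ * X.dist p p' - C ≤ X'.dist (φ p) (φ p') ∧
    X'.dist (φ p) (φ p') ≤ κ * X.dist p p' + C) ∧
  ∀ p', ∃ p, X'.dist (φ p) p' ≤ C

/-- The volume (up to a constant factor in the case of graphs), computed in the coordinates
`(x, y, z)`. -/
def vol (D : Set X.Pt) : ENNReal :=
  ((X.lowerMeasure.prod X.upperMeasure).prod volume) {c | X.pt c.1.1 c.1.2 c.2 ∈ D}

/-- Measurability, in the coordinates `(x, y, z)`. -/
def IsMeasurable (D : Set X.Pt) : Prop :=
  MeasurableSet {c : (X.Lower × X.Upper) × ℝ | X.pt c.1.1 c.1.2 c.2 ∈ D}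

/-- The coarsening of a subset of the upper boundary. -/
def coarsenUpper (z : ℝ) (F : Set X.Upper) : Set X.Upper :=
  {y | ∃ y' ∈ F, (z : EReal) < X.hMinus y y'}

/-- The `y`-horocycle at height `h` through the point `x` (that is, through the points `(x, y, h)`). -/
def yHorocycle (x : X.Lower) (h : ℝ) : Set X.Pt := {p | ∃ y, p = X.pt x y h}

/-- The lower boundary points of the vertical geodesic rays that start within distance `ρ` of `H` and
go down. -/
def piMinus (ρ : ℝ) (H : Set X.Pt) : Set X.Lower :=
  {x | ∃ y z, ∃ p ∈ H, X.dist (X.pt x y z) p ≤ ρ}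

/-- The generalized slab: the points with heights strictly between `h₂` and `h₁` on geodesics joining
points of `E` to points of `F`. -/
def slab (E : Set X.Lower) (F : Set X.Upper) (h₂ h₁ : ℝ) : Set X.Pt :=
  {p | ∃ x ∈ E, ∃ y ∈ F, ∃ z, h₂ < z ∧ z < h₁ ∧ p = X.pt x y z}

/-- The `y` coordinates in `F` of the points of `D`. -/
def yCoords (F : Set X.Upper) (D : Set X.Pt) : Set X.Upper :=
  {y ∈ F | ∃ x z, X.pt x y z ∈ D}

/-- The set `{(x, y, z) | x ∈ E, y ∈ F, z ∈ [a, b]}`. -/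
def productSet (E : Set X.Lower) (F : Set X.Upper) (a b : ℝ) : Set X.Pt :=
  {p | ∃ x ∈ E, ∃ y ∈ F, ∃ z ∈ Icc a b, p = X.pt x y z}

/-- On the box `B(R) = S_X × S_Y × [h_bot, h_top]`, the map `φ` is within `δ R` of the product map
`(x, y, z) ↦ (f x, g y, q z)`, on the set of all `(x, y, z)` with `x ∈ E₁ ⊆ S_X`, `y ∈ E₂ ⊆ S_Y`,
where `E₁, E₂` have relative measure at least `1 - θ`. -/
structure IsAlmostProduct (R δ θ : ℝ) (SX : Set X.Lower) (SY : Set X.Upper) (hbot htop : ℝ)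
    (φ : X.Pt → X'.Pt) (E₁ : Set X.Lower) (E₂ : Set X.Upper)
    (f : X.Lower → X'.Lower) (g : X.Upper → X'.Upper) (q : ℝ → ℝ) : Prop where
  subset_lower : E₁ ⊆ SX
  subset_upper : E₂ ⊆ SY
  measurable_lower : MeasurableSet E₁
  measurable_upper : MeasurableSet E₂
  measure_lower : ENNReal.ofReal (1 - θ) * X.lowerMeasure SX ≤ X.lowerMeasure E₁
  measure_upper : ENNReal.ofReal (1 - θ) * X.upperMeasure SY ≤ X.upperMeasure E₂
  close : ∀ x ∈ E₁, ∀ y ∈ E₂, ∀ z ∈ Icc hbot htop,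
    X'.dist (φ (X.pt x y z)) (X'.pt (f x) (g y) (q z)) ≤ δ * R

end ModelSpace

end

/-! In the coordinates (x, y, z) the volume is the product measure |dx||dy|dz. Boundary points whose
vertical geodesics are close at height z form balls of measure about e^{Bz} below and e^{-Bz} above,
B being the branching constant. These two factors cancel, so metric balls of bounded radius have
volume bounded above and below, uniformly in the height. Hence φ and its coarse inverse decrease
volumes, after thickening, by at most a constant factor.

Slope. Take a slab of thickness w at height z₁ over most of E₁ × E₂, map it by φ, translate it
vertically in X' by q(z₂) - q(z₁), which preserves volume, and pull it back by a coarse inverse. If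
z₁ and z₂ are far from the top and the bottom, the result stays inside the box. The part of it that
misses the good set has volume at most of order θR|S_X||S_Y|, which is negligible against the slab
when w = √θ R. A remaining point of the translated slab has its lower coordinate near f(E₁) at the
scale of q(z₁), as before the translation, and its upper coordinate near g(E₂) at the scale of
q(z₂), as after it. Covering E₁ by balls at height z₁ and E₂ by balls at height z₂ bounds the two
neighbourhoods by |S_X|e^{B'q(z₁) - Bz₁} and |S_Y|e^{-B'q(z₂) + Bz₂}, up to factors e^{O(e)} with e
the error in heights. So B'(q(z₂) - q(z₁)) ≤ B(z₂ - z₁) + o(R), and exchanging z₁ and z₂ gives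
equality up to o(R). This is `width_le`.

Constant term. For F ⊆ E₂ of at least half the measure of S_Y, the same covering bounds the
coarsening of g(F) at height q(z₁) above by |S_Y|e^{Bz₁ - B'q(z₁)}. The volume of the image of a
slab over E₁ × F bounds it below by the same quantity, up to e^{o(R)}. Its logarithm is therefore
the constant term.

The set E_*. By Fubini and Markov, above most x the bad set is small. Above such an x most y ∈ E₂
meet U_* in any layer of thickness β''R inside the box, so a horocycle whose π_- contains one such x
yields a large F (`exists_good_lower`).

Only the axioms `IsScale`, `IsWide` and `IsCoarse` enter this argument; they are checked at the end
for Sol(n) and DL(n,n). -/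

/-! ### Covering versus packing -/

/-- Every set contains a maximal subset of pairwise unrelated points. -/
theorem exists_maximal_pairwise_not {ι : Type*} (r : ι → ι → Prop) (hrefl : ∀ a, r a a)
    (hsymm : ∀ a b, r a b → r b a) (F : Set ι) :
    ∃ T ⊆ F, T.Pairwise (fun a b => ¬ r a b) ∧ ∀ y ∈ F, ∃ x ∈ T, r x y := by
  obtain ⟨T, hT⟩ := zorn_subset {T : Set ι | T ⊆ F ∧ T.Pairwise (fun a b => ¬ r a b)} (by
    intro c hc hchain
    refine ⟨⋃₀ c, ⟨sUnion_subset fun s hs => (hc hs).1, ?_⟩, fun s hs => subset_sUnion_of_mem hs⟩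
    exact (pairwise_sUnion hchain.directedOn).2 fun s hs => (hc hs).2)
  refine ⟨T, hT.prop.1, hT.prop.2, fun y hy => ?_⟩
  by_contra! hcon
  have hins : insert y T ∈ {T : Set ι | T ⊆ F ∧ T.Pairwise (fun a b => ¬ r a b)} := by
    refine ⟨insert_subset hy hT.prop.1, hT.prop.2.insert fun b hb _ => ?_⟩
    exact ⟨fun h => hcon b hb (hsymm _ _ h), hcon b hb⟩
  have := hT.eq_of_subset hins (subset_insert y T)
  exact hcon y (this ▸ mem_insert y T) (hrefl y)

/-- Comparison of a covering with a packing: `D` is covered by sets of measure at most `a`, indexed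
by any maximal family of unrelated points, and unrelated points carry disjoint sets of measure at
least `b`. -/
theorem measure_le_of_packing {ι β γ : Type*} [MeasurableSpace β] [MeasurableSpace γ]
    (μ : Measure γ) (ν : Measure β) [SFinite ν] (F : Set ι) (r : ι → ι → Prop)
    (hrefl : ∀ a, r a a) (hsymm : ∀ a b, r a b → r b a)
    (P : ι → Set β) (Q : ι → Set γ) (D : Set γ) (a b : ENNReal) (hb : b ≠ 0)
    (hQ : ∀ x ∈ F, μ (Q x) ≤ a) (hPm : ∀ x, MeasurableSet (P x)) (hP : ∀ x ∈ F, b ≤ ν (P x))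
    (hdisj : ∀ x ∈ F, ∀ y ∈ F, ¬ r x y → Disjoint (P x) (P y))
    (hD : ∀ d ∈ D, ∃ y ∈ F, ∀ x ∈ F, r x y → d ∈ Q x) :
    b * μ D ≤ a * ν (⋃ x ∈ F, P x) := by
  obtain ⟨T, hTF, hTp, hTc⟩ := exists_maximal_pairwise_not r hrefl hsymm F
  have hdis : Pairwise (Function.onFun Disjoint fun x : T => P x) := fun x y hxy =>
    hdisj x (hTF x.2) y (hTF y.2) (hTp x.2 y.2 fun h => hxy (Subtype.ext h))
  have hcount : Countable T := by
    -- An s-finite measure admits only countably many disjoint sets of positive measure, which makes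
    -- the sums over `T` additive.
    have h := Measure.countable_meas_pos_of_disjoint_iUnion (μ := ν)
      (As := fun x : T => P x) (fun x => hPm x) hdis
    have huniv : {i : T | 0 < ν (P i)} = univ := by
      ext i
      simp only [mem_ofPred_eq, mem_univ, iff_true]
      exact (pos_iff_ne_zero.2 hb).trans_le (hP i (hTF i.2))
    rw [huniv] at h
    exact countable_univ_iff.1 h
  have h1 : μ D ≤ ∑' _ : T, a := by
    calc μ D ≤ μ (⋃ x : T, Q x) := by
          refine measure_mono fun d hd => ?_
          obtain ⟨y, hy, h⟩ := hD d hd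
          obtain ⟨x, hx, hxy⟩ := hTc y hy
          exact mem_iUnion.2 ⟨⟨x, hx⟩, h x (hTF hx) hxy⟩
      _ ≤ ∑' x : T, μ (Q x) := measure_iUnion_le _
      _ ≤ _ := ENNReal.tsum_le_tsum fun x => hQ x (hTF x.2)
  have h2 : ∑' _ : T, b ≤ ν (⋃ x ∈ F, P x) := by
    calc ∑' _ : T, b ≤ ∑' x : T, ν (P x) := ENNReal.tsum_le_tsum fun x => hP x (hTF x.2)
      _ = ν (⋃ x : T, P x) := (measure_iUnion hdis fun x => hPm x).symm
      _ ≤ _ := by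
          refine measure_mono (iUnion_subset fun x => ?_)
          exact subset_biUnion_of_mem (u := P) (hTF x.2)
  calc b * μ D ≤ b * ∑' _ : T, a := by gcongr
    _ = a * ∑' _ : T, b := by
        rw [← ENNReal.tsum_mul_left, ← ENNReal.tsum_mul_left]
        simp only [mul_comm]
    _ ≤ _ := by gcongr

/-! ### Scales and thickenings -/

/-- `N t a b` says that `a` and `b` are close at the scale `exp t`; the balls at this scale have
measure comparable to `exp (B t)`. -/
structure IsScale {α : Type*} [MeasurableSpace α] (μ : Measure α) (B c : ℝ)
    (N : ℝ → α → α → Prop) : Prop where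
  one_le : 1 ≤ c
  refl : ∀ t a, N t a a
  symm : ∀ {t a b}, N t a b → N t b a
  mono : ∀ {s t a b}, s ≤ t → N s a b → N t a b
  trans : ∀ {t a b d}, N t a b → N t b d → N (t + c) a d
  measurable : ∀ t a, MeasurableSet {b | N t a b}
  le_measure : ∀ t a, ENNReal.ofReal (c⁻¹ * Real.exp (B * t)) ≤ μ {b | N t a b}
  measure_le : ∀ t a, μ {b | N t a b} ≤ ENNReal.ofReal (c * Real.exp (B * t))

/-- The points that are close to `A` at the scale `exp t`. -/
def thick {α : Type*} (N : ℝ → α → α → Prop) (t : ℝ) (A : Set α) : Set α := {b | ∃ a ∈ A, N t a b}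

namespace IsScale

variable {α α' : Type*} [MeasurableSpace α] [MeasurableSpace α'] {μ : Measure α} {μ' : Measure α'}
  {B B' c c' : ℝ} {N : ℝ → α → α → Prop} {N' : ℝ → α' → α' → Prop}

theorem thick_mono (S : IsScale μ B c N) {s t : ℝ} (h : s ≤ t) {A A' : Set α} (hA : A ⊆ A') :
    thick N s A ⊆ thick N t A' := fun _ ⟨a, ha, hab⟩ => ⟨a, hA ha, S.mono h hab⟩

theorem trans' (S : IsScale μ B c N) {s t u : ℝ} {a b d : α} (h₁ : N s a b) (h₂ : N t b d)
    (hs : s + c ≤ u) (ht : t + c ≤ u) : N u a d :=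
  S.mono (t := u) (s := (u - c) + c) (by linarith)
    (S.trans (S.mono (by linarith) h₁) (S.mono (by linarith) h₂))

/-- Points of `E` unrelated at scale `t` have disjoint balls at scale `t - c`, since a common point
would relate them by `trans`. The images of a maximal unrelated family, thickened to scale `t' +
c'`, cover the thickened image. Injectivity of `f` plays no role. -/
theorem measure_thick_image_le [SFinite μ] (S : IsScale μ B c N) (S' : IsScale μ' B' c' N')
    (f : α → α') (E : Set α) (t t' : ℝ) (h : ∀ x ∈ E, ∀ y ∈ E, N t x y → N' t' (f x) (f y)) :
    ENNReal.ofReal (c⁻¹ * Real.exp (B * (t - c))) * μ' (thick N' t' (f '' E)) ≤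
      ENNReal.ofReal (c' * Real.exp (B' * (t' + c'))) * μ (thick N (t - c) E) := by
  have hc : 0 < c := zero_lt_one.trans_le S.one_le
  have key := measure_le_of_packing μ' μ E (N t) (S.refl t) (fun a b => S.symm)
    (fun x => {y | N (t - c) x y}) (fun x => {y | N' (t' + c') (f x) y}) (thick N' t' (f '' E))
    (ENNReal.ofReal (c' * Real.exp (B' * (t' + c'))))
    (ENNReal.ofReal (c⁻¹ * Real.exp (B * (t - c))))
    (ENNReal.ofReal_pos.2 (by positivity)).ne'
    (fun x _ => S'.measure_le _ _) (fun x => S.measurable _ _) (fun x _ => S.le_measure _ _)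
    (fun x _ y _ hxy => Set.disjoint_left.2 fun b hb hb' => hxy
      (S.trans' hb (S.symm hb') (by linarith) (by linarith)))
    (by
      rintro d ⟨_, ⟨y, hy, rfl⟩, hyd⟩
      exact ⟨y, hy, fun x hx hxy => S'.trans (h x hx y hy hxy) hyd⟩)
  refine key.trans ?_
  gcongr
  intro b hb
  simp only [mem_iUnion] at hb
  obtain ⟨x, hx, hxb⟩ := hb
  exact ⟨x, hx, hxb⟩

/-- With `s` in the role of the measure of the ambient set, about `s e^{-Bt}` balls cover `E` and
each contributes about `e^{B't'}` to the image. This ratio carries all the information about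
heights. -/
theorem measure_thick_image_le_mul_exp [SFinite μ] (S : IsScale μ B c N) (S' : IsScale μ' B' c' N')
    (f : α → α') (E : Set α) (t t' s : ℝ)
    (h : ∀ x ∈ E, ∀ y ∈ E, N t x y → N' t' (f x) (f y))
    (hs : μ (thick N (t - c) E) ≤ ENNReal.ofReal (c * s)) :
    μ' (thick N' t' (f '' E)) ≤ ENNReal.ofReal
      (c ^ 2 * c' * Real.exp (B * c + B' * c') * (s * Real.exp (B' * t' - B * t))) := by
  have hc : 0 < c := zero_lt_one.trans_le S.one_le
  have hc' : 0 < c' := zero_lt_one.trans_le S'.one_le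
  have key := S.measure_thick_image_le S' f E t t' h
  have hpos : 0 < c⁻¹ * Real.exp (B * (t - c)) := by positivity
  rw [← ENNReal.mul_le_mul_iff_right (a := ENNReal.ofReal (c⁻¹ * Real.exp (B * (t - c))))
    (ENNReal.ofReal_pos.2 hpos).ne' ENNReal.ofReal_ne_top, ← ENNReal.ofReal_mul hpos.le]
  refine key.trans ?_
  refine (mul_le_mul_right hs _).trans ?_
  rw [← ENNReal.ofReal_mul (by positivity)]
  refine ENNReal.ofReal_le_ofReal (le_of_eq ?_)
  have e1 : Real.exp (B' * (t' + c')) = Real.exp (B * (t - c)) * Real.exp (B * c + B' * c') *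
      Real.exp (B' * t' - B * t) := by
    rw [← Real.exp_add, ← Real.exp_add]; congr 1; ring
  rw [e1]; field_simp

/-- Thickening further increases the measure at most by the expected factor. -/
theorem measure_thick_le_exp_mul [SFinite μ] (S : IsScale μ B c N) (A : Set α) (t e : ℝ)
    (he : c ≤ e) : μ (thick N (t + e) A) ≤
      ENNReal.ofReal (c ^ 2 * Real.exp (B * (e + c))) * μ (thick N t A) := by
  have hc : 0 < c := zero_lt_one.trans_le S.one_le
  -- The source scale `t + c` makes the packing balls have scale exactly `t`; the target scale `t +
  -- e` is admissible because `c ≤ e`.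
  have key := S.measure_thick_image_le S id A (t + c) (t + e)
    (fun x _ y _ h => S.mono (by linarith) h)
  rw [image_id, add_sub_cancel_right] at key
  have hpos : 0 < c⁻¹ * Real.exp (B * t) := by positivity
  rw [← ENNReal.mul_le_mul_iff_right (a := ENNReal.ofReal (c⁻¹ * Real.exp (B * t)))
    (ENNReal.ofReal_pos.2 hpos).ne' ENNReal.ofReal_ne_top, ← mul_assoc,
    ← ENNReal.ofReal_mul hpos.le]
  refine key.trans (le_of_eq ?_)
  congr 2
  rw [show B * (t + e + c) = B * t + B * (e + c) by ring, Real.exp_add]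
  field_simp

end IsScale

/-- `S` is large compared with the balls at scale `exp t`. -/
structure IsWide {α : Type*} [MeasurableSpace α] (μ : Measure α) (N : ℝ → α → α → Prop)
    (c t θ : ℝ) (S : Set α) : Prop where
  measurable : MeasurableSet S
  pos : 0 < μ S
  lt_top : μ S < ⊤
  thick_le : μ (thick N t S) ≤ ENNReal.ofReal c * μ S
  interior : ∃ S' ⊆ S, μ (S \ S') ≤ ENNReal.ofReal θ * μ S ∧ ∀ x ∈ S', ∀ x', N t x x' → x' ∈ S

/-! ### Coarse geometry and volume of a model space -/

namespace ModelSpace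

/-- The triples `(x, y, z)`. -/
abbrev Coord (X : ModelSpace) : Type := (X.Lower × X.Upper) × ℝ

/-- The point with coordinates `(x, y, z)`. -/
def ofCoord (X : ModelSpace) (w : X.Coord) : X.Pt := X.pt w.1.1 w.1.2 w.2

/-- The volume in the coordinates `(x, y, z)`. -/
noncomputable def coordMeasure (X : ModelSpace) : Measure X.Coord :=
  (X.lowerMeasure.prod X.upperMeasure).prod volume

/-- The coarse geometry of a model space: `NL z x x'` and `NU (-z) y y'` say that the vertical
geodesics over `x, x'`, respectively over `y, y'`, are close at height `z`. -/
structure IsCoarse (X : ModelSpace) (c : ℝ) (NL : ℝ → X.Lower → X.Lower → Prop)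
    (NU : ℝ → X.Upper → X.Upper → Prop) : Prop where
  scaleL : IsScale X.lowerMeasure X.branching c NL
  scaleU : IsScale X.upperMeasure X.branching c NU
  sigmaFiniteL : SigmaFinite X.lowerMeasure
  sigmaFiniteU : SigmaFinite X.upperMeasure
  branching_pos : 0 < X.branching
  surj : ∀ p, ∃ x y z, X.pt x y z = p
  dist_comm : ∀ p q, X.dist p q = X.dist q p
  dist_triangle : ∀ p q r, X.dist p r ≤ X.dist p q + X.dist q r
  dist_vert : ∀ x y z z', X.dist (X.pt x y z) (X.pt x y z') ≤ |z - z'|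
  dist_lower : ∀ x x' y z, NL z x x' → X.dist (X.pt x y z) (X.pt x' y z) ≤ c
  dist_upper : ∀ x y y' (z : ℝ), NU (-z) y y' → X.dist (X.pt x y z) (X.pt x y' z) ≤ c
  abs_sub_le : ∀ x y z x' y' z', |z - z'| ≤ X.dist (X.pt x y z) (X.pt x' y' z')
  nl_of_dist : ∀ x y (z : ℝ) x' y' z' (L : ℝ), X.dist (X.pt x y z) (X.pt x' y' z') ≤ L →
    NL (z + c * (L + 1)) x x'
  nu_of_dist : ∀ x y (z : ℝ) x' y' z' (L : ℝ), X.dist (X.pt x y z) (X.pt x' y' z') ≤ L →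
    NU (-z + c * (L + 1)) y y'
  lt_hMinus : ∀ (z : ℝ) y y', NU (-z - 1) y y' → (z : EReal) < X.hMinus y y'
  nu_of_lt : ∀ (z : ℝ) y y', (z : EReal) < X.hMinus y y' → NU (-z) y y'
  coord_eq : ∀ x y (z : ℝ) x' y' (z' : ℝ), X.pt x y z = X.pt x' y' z' → NL z x x' ∧ NU (-z) y y' ∧ z = z'
  box : ∀ θ : ℝ, 0 < θ → ∃ R₀ : ℝ, ∀ R, R₀ ≤ R → ∀ SX SY hbot htop, X.IsBox R SX SY hbot htop →
    R ≤ htop - hbot ∧ htop - hbot ≤ R + 1 ∧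
    IsWide X.lowerMeasure NL c htop θ SX ∧ IsWide X.upperMeasure NU c (-hbot) θ SY

namespace IsCoarse

variable {X : ModelSpace} {c : ℝ} {NL : ℝ → X.Lower → X.Lower → Prop}
  {NU : ℝ → X.Upper → X.Upper → Prop}

theorem coordMeasure_prod (H : X.IsCoarse c NL NU) (A : Set X.Lower) (A' : Set X.Upper)
    (I : Set ℝ) :
    X.coordMeasure ((A ×ˢ A') ×ˢ I) = X.lowerMeasure A * X.upperMeasure A' * volume I := by
  have := H.sigmaFiniteL
  have := H.sigmaFiniteU
  rw [coordMeasure, Measure.prod_prod, Measure.prod_prod]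

theorem sigmaFinite_coordMeasure (H : X.IsCoarse c NL NU) : SigmaFinite X.coordMeasure := by
  have := H.sigmaFiniteL
  have := H.sigmaFiniteU
  unfold coordMeasure
  infer_instance

theorem one_le (H : X.IsCoarse c NL NU) : 1 ≤ c := H.scaleL.one_le

theorem pos (H : X.IsCoarse c NL NU) : 0 < c := zero_lt_one.trans_le H.one_le

theorem dist_nonneg (H : X.IsCoarse c NL NU) (p q : X.Pt) : 0 ≤ X.dist p q := by
  obtain ⟨x, y, z, rfl⟩ := H.surj p
  obtain ⟨x', y', z', rfl⟩ := H.surj q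
  exact (abs_nonneg _).trans (H.abs_sub_le x y z x' y' z')

theorem dist_self (H : X.IsCoarse c NL NU) (p : X.Pt) : X.dist p p = 0 := by
  refine le_antisymm ?_ (H.dist_nonneg p p)
  obtain ⟨x, y, z, rfl⟩ := H.surj p
  simpa using H.dist_vert x y z z

/-- The points obtained from `w` by small changes of each coordinate. -/
def cell (X : ModelSpace) (NL : ℝ → X.Lower → X.Lower → Prop) (NU : ℝ → X.Upper → X.Upper → Prop)
    (w : X.Coord) : Set X.Coord :=
  ({x | NL w.2 w.1.1 x} ×ˢ {y | NU (-w.2) w.1.2 y}) ×ˢ Icc w.2 (w.2 + 1)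

theorem measurableSet_cell (H : X.IsCoarse c NL NU) (w : X.Coord) :
    MeasurableSet (cell X NL NU w) :=
  ((H.scaleL.measurable _ _).prod (H.scaleU.measurable _ _)).prod measurableSet_Icc

theorem dist_le_of_mem_cell (H : X.IsCoarse c NL NU) {w v : X.Coord} (hv : v ∈ cell X NL NU w) :
    X.dist (X.ofCoord w) (X.ofCoord v) ≤ 2 * c + 1 := by
  obtain ⟨⟨x, y⟩, z⟩ := w
  obtain ⟨⟨x', y'⟩, z'⟩ := v
  obtain ⟨⟨hx, hy⟩, hz⟩ := hv
  simp only [mem_ofPred_eq] at hx hy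
  simp only [mem_Icc] at hz
  have h1 := H.dist_lower x x' y z hx
  have h2 := H.dist_upper x' y y' z hy
  have h3 := H.dist_vert x' y' z z'
  have h4 : |z - z'| ≤ 1 := by rw [abs_le]; constructor <;> linarith
  have h5 := H.dist_triangle (X.pt x y z) (X.pt x' y z) (X.pt x' y' z')
  have h6 := H.dist_triangle (X.pt x' y z) (X.pt x' y' z) (X.pt x' y' z')
  simp only [ofCoord]
  linarith

/-- The lower factor grows like `e^{Bz}` and the upper one decays like `e^{-Bz}`. Their product is
independent of the height: this is unimodularity. -/
theorem le_coordMeasure_cell (H : X.IsCoarse c NL NU) (w : X.Coord) :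
    ENNReal.ofReal ((c⁻¹) ^ 2) ≤ X.coordMeasure (cell X NL NU w) := by
  have hc := H.pos
  rw [cell, H.coordMeasure_prod, Real.volume_Icc]
  have h1 := H.scaleL.le_measure w.2 w.1.1
  have h2 := H.scaleU.le_measure (-w.2) w.1.2
  calc ENNReal.ofReal ((c⁻¹) ^ 2) = ENNReal.ofReal (c⁻¹ * Real.exp (X.branching * w.2)) *
        ENNReal.ofReal (c⁻¹ * Real.exp (X.branching * -w.2)) * ENNReal.ofReal (w.2 + 1 - w.2) := by
        rw [← ENNReal.ofReal_mul (by positivity), ← ENNReal.ofReal_mul (by positivity)]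
        congr 1
        have : Real.exp (X.branching * w.2) * Real.exp (X.branching * -w.2) = 1 := by
          rw [← Real.exp_add]; simp
        calc c⁻¹ ^ 2 = c⁻¹ ^ 2 * 1 * 1 := by ring
          _ = _ := by rw [← this]; ring
    _ ≤ _ := by gcongr

/-- The same cancellation as for cells, applied to the product of coordinate balls that contains a
metric ball. -/
theorem coordMeasure_ball_le (H : X.IsCoarse c NL NU) (w : X.Coord) (r : ℝ) :
    X.coordMeasure {v | X.dist (X.ofCoord w) (X.ofCoord v) ≤ r} ≤
      ENNReal.ofReal (c ^ 2 * Real.exp (2 * X.branching * (c * (r + 1))) * (2 * r)) := by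
  have hc := H.pos
  obtain ⟨⟨x, y⟩, z⟩ := w
  calc X.coordMeasure {v | X.dist (X.ofCoord ((x, y), z)) (X.ofCoord v) ≤ r}
      ≤ X.coordMeasure (({x' | NL (z + c * (r + 1)) x x'} ×ˢ {y' | NU (-z + c * (r + 1)) y y'}) ×ˢ
          Icc (z - r) (z + r)) := by
        refine measure_mono ?_
        rintro ⟨⟨x', y'⟩, z'⟩ hv
        simp only [ofCoord, mem_ofPred_eq] at hv
        refine ⟨⟨H.nl_of_dist _ _ _ _ _ _ _ hv, H.nu_of_dist _ _ _ _ _ _ _ hv⟩, ?_⟩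
        have := abs_le.1 ((H.abs_sub_le _ _ _ _ _ _).trans hv)
        constructor <;> simp only <;> linarith
    _ ≤ _ := by
        rw [H.coordMeasure_prod, Real.volume_Icc]
        have h1 := H.scaleL.measure_le (z + c * (r + 1)) x
        have h2 := H.scaleU.measure_le (-z + c * (r + 1)) y
        refine (mul_le_mul' (mul_le_mul' h1 h2) le_rfl).trans (le_of_eq ?_)
        rw [← ENNReal.ofReal_mul (by positivity), ← ENNReal.ofReal_mul (by positivity)]
        congr 1
        have : Real.exp (X.branching * (z + c * (r + 1))) *
            Real.exp (X.branching * (-z + c * (r + 1))) =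
            Real.exp (2 * X.branching * (c * (r + 1))) := by
          rw [← Real.exp_add]; congr 1; ring
        rw [← this]; ring

end IsCoarse

/-- A map that separates points coarsely does not decrease volumes by more than a constant factor,
after thickening. -/
theorem exists_coordMeasure_le {X X' : ModelSpace} {c c' : ℝ} {NL : ℝ → X.Lower → X.Lower → Prop}
    {NU : ℝ → X.Upper → X.Upper → Prop} {NL' : ℝ → X'.Lower → X'.Lower → Prop}
    {NU' : ℝ → X'.Upper → X'.Upper → Prop} (H : X.IsCoarse c NL NU) (H' : X'.IsCoarse c' NL' NU')
    {r : ℝ} (hr : 0 ≤ r) :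
    ∃ M : ℝ, 0 < M ∧ ∀ (W : Set X.Coord) (ψ : X.Coord → X'.Pt),
      (∀ w ∈ W, ∀ w' ∈ W, X'.dist (ψ w) (ψ w') ≤ 2 * (2 * c' + 1) →
        X.dist (X.ofCoord w) (X.ofCoord w') ≤ r) →
      X.coordMeasure W ≤ ENNReal.ofReal M *
        X'.coordMeasure {v | ∃ w ∈ W, X'.dist (ψ w) (X'.ofCoord v) ≤ 2 * c' + 1} := by
  have hc := H.pos
  have hc' := H'.pos
  have := H'.sigmaFinite_coordMeasure
  set a : ℝ := c ^ 2 * Real.exp (2 * X.branching * (c * (r + 1))) * (2 * r)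
  have ha : 0 ≤ a := by positivity
  -- The factor `c'^2` inverts the lower bound on the volume of a cell; the `+ 1` keeps the constant
  -- positive when `r = 0`.
  refine ⟨c' ^ 2 * (a + 1), by positivity, fun W ψ h => ?_⟩
  have hex : ∀ w, ∃ v : X'.Coord, X'.ofCoord v = ψ w := fun w => by
    obtain ⟨x, y, z, hxyz⟩ := H'.surj (ψ w)
    exact ⟨((x, y), z), hxyz⟩
  choose σ hσ using hex
  have key := measure_le_of_packing X.coordMeasure X'.coordMeasure W
    (fun w w' => X.dist (X.ofCoord w) (X.ofCoord w') ≤ r)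
    (fun w => by rw [H.dist_self]; exact hr)
    (fun w w' hw => by rw [H.dist_comm]; exact hw)
    (fun w => IsCoarse.cell X' NL' NU' (σ w))
    (fun w => {v | X.dist (X.ofCoord w) (X.ofCoord v) ≤ r}) W
    (ENNReal.ofReal a) (ENNReal.ofReal ((c'⁻¹) ^ 2))
    (ENNReal.ofReal_pos.2 (by positivity)).ne'
    (fun w _ => H.coordMeasure_ball_le w r) (fun w => H'.measurableSet_cell _)
    (fun w _ => H'.le_coordMeasure_cell _)
    (fun w hw w' hw' hww => Set.disjoint_left.2 fun v hv hv' => hww (h w hw w' hw' (by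
      have h1 := H'.dist_le_of_mem_cell hv
      have h2 := H'.dist_le_of_mem_cell hv'
      have h3 := H'.dist_triangle (X'.ofCoord (σ w)) (X'.ofCoord v) (X'.ofCoord (σ w'))
      rw [H'.dist_comm (X'.ofCoord v)] at h3
      rw [← hσ w, ← hσ w']
      linarith)))
    (fun w hw => ⟨w, hw, fun _ _ hx => hx⟩)
  have hsub : (⋃ w ∈ W, IsCoarse.cell X' NL' NU' (σ w)) ⊆
      {v | ∃ w ∈ W, X'.dist (ψ w) (X'.ofCoord v) ≤ 2 * c' + 1} := by
    intro v hv
    simp only [mem_iUnion] at hv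
    obtain ⟨w, hw, hv⟩ := hv
    exact ⟨w, hw, by rw [← hσ w]; exact H'.dist_le_of_mem_cell hv⟩
  rw [← ENNReal.mul_le_mul_iff_right (a := ENNReal.ofReal ((c'⁻¹) ^ 2))
    (ENNReal.ofReal_pos.2 (by positivity)).ne' ENNReal.ofReal_ne_top, ← mul_assoc,
    ← ENNReal.ofReal_mul (by positivity)]
  refine key.trans (mul_le_mul' (ENNReal.ofReal_le_ofReal ?_) (measure_mono hsub))
  rw [← mul_assoc, ← mul_pow, inv_mul_cancel₀ hc'.ne']
  linarith

end ModelSpace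

/-! ### Quasi-isometries close to product maps -/

namespace ModelSpace

/-- A quasi-isometry that is within `Δ` of a product map on `E₁ × E₂ × [hbot, htop]`. -/
structure IsNearProduct (X X' : ModelSpace) (κ C Δ : ℝ) (E₁ : Set X.Lower) (E₂ : Set X.Upper)
    (hbot htop : ℝ) (φ : X.Pt → X'.Pt) (f : X.Lower → X'.Lower) (g : X.Upper → X'.Upper)
    (q : ℝ → ℝ) : Prop where
  one_le : 1 ≤ κ
  C_nonneg : 0 ≤ C
  delta_nonneg : 0 ≤ Δ
  quasi : X.IsQuasiIsometry X' κ C φ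
  nonempty_lower : E₁.Nonempty
  nonempty_upper : E₂.Nonempty
  close : ∀ x ∈ E₁, ∀ y ∈ E₂, ∀ z ∈ Icc hbot htop,
    X'.dist (φ (X.pt x y z)) (X'.pt (f x) (g y) (q z)) ≤ Δ

section

variable {X X' : ModelSpace} {κ C : ℝ} {φ : X.Pt → X'.Pt}

theorem IsQuasiIsometry.dist_le (h : X.IsQuasiIsometry X' κ C φ) (hκ : 0 < κ) {p p' : X.Pt} {L : ℝ}
    (hL : X'.dist (φ p) (φ p') ≤ L) : X.dist p p' ≤ κ * (L + C) := by
  have h1 := (h.1 p p').1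
  rw [← inv_mul_le_iff₀ hκ]
  linarith

variable {c c' Δ hbot htop : ℝ} {NL : ℝ → X.Lower → X.Lower → Prop}
  {NU : ℝ → X.Upper → X.Upper → Prop} {NL' : ℝ → X'.Lower → X'.Lower → Prop}
  {NU' : ℝ → X'.Upper → X'.Upper → Prop} {E₁ : Set X.Lower} {E₂ : Set X.Upper}
  {f : X.Lower → X'.Lower} {g : X.Upper → X'.Upper} {q : ℝ → ℝ}

/-- A quasi-isometry does not decrease volumes by more than a constant factor. -/
theorem exists_coordMeasure_le_image (H : X.IsCoarse c NL NU) (H' : X'.IsCoarse c' NL' NU')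
    (hκ : 1 ≤ κ) (hC : 0 ≤ C) :
    ∃ M : ℝ, 0 < M ∧ ∀ φ : X.Pt → X'.Pt, X.IsQuasiIsometry X' κ C φ → ∀ W : Set X.Coord,
      X.coordMeasure W ≤ ENNReal.ofReal M *
        X'.coordMeasure {v | ∃ w ∈ W, X'.dist (φ (X.ofCoord w)) (X'.ofCoord v) ≤ 2 * c' + 1} := by
  have hc' := H'.pos
  have hκ0 : 0 < κ := zero_lt_one.trans_le hκ
  -- This `r` is the distance in the source forced by the distance `2(2c' + 1)` between image
  -- points.
  obtain ⟨M, hM, h⟩ := exists_coordMeasure_le H H' (r := κ * (2 * (2 * c' + 1) + C)) (by positivity)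
  exact ⟨M, hM, fun φ hφ W => h W (fun w => φ (X.ofCoord w))
    fun w _ w' _ hww => hφ.dist_le hκ0 hww⟩

/-- A coarse inverse of a quasi-isometry does not decrease volumes by more than a constant factor. -/
theorem exists_coordMeasure_le_preimage (H : X.IsCoarse c NL NU) (H' : X'.IsCoarse c' NL' NU')
    (hκ : 1 ≤ κ) (hC : 0 ≤ C) :
    ∃ M : ℝ, 0 < M ∧ ∀ φ : X.Pt → X'.Pt, X.IsQuasiIsometry X' κ C φ → ∀ ψ : X'.Coord → X.Pt,
      (∀ v, X'.dist (φ (ψ v)) (X'.ofCoord v) ≤ C) → ∀ V : Set X'.Coord,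
      X'.coordMeasure V ≤ ENNReal.ofReal M *
        X.coordMeasure {w | ∃ v ∈ V, X.dist (ψ v) (X.ofCoord w) ≤ 2 * c + 1} := by
  have hc := H.pos
  have hκ0 : 0 < κ := zero_lt_one.trans_le hκ
  obtain ⟨M, hM, h⟩ := exists_coordMeasure_le H' H (r := κ * (2 * (2 * c + 1)) + 3 * C)
    (by positivity)
  refine ⟨M, hM, fun φ hφ ψ hψ V => h V ψ fun v _ v' _ hvv => ?_⟩
  have h1 := (hφ.1 (ψ v) (ψ v')).2
  have h2 := H'.dist_triangle (X'.ofCoord v) (φ (ψ v)) (X'.ofCoord v')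
  have h3 := H'.dist_triangle (φ (ψ v)) (φ (ψ v')) (X'.ofCoord v')
  rw [H'.dist_comm (X'.ofCoord v) (φ (ψ v))] at h2
  have h4 := hψ v
  have h5 := hψ v'
  have h6 := mul_le_mul_of_nonneg_left hvv hκ0.le
  linarith

namespace IsNearProduct

theorem kappa_pos (P : IsNearProduct X X' κ C Δ E₁ E₂ hbot htop φ f g q) : 0 < κ :=
  zero_lt_one.trans_le P.one_le

theorem dist_le (P : IsNearProduct X X' κ C Δ E₁ E₂ hbot htop φ f g q)
    (H' : X'.IsCoarse c' NL' NU') {x x' : X.Lower} {y y' : X.Upper} {z z' : ℝ} (hx : x ∈ E₁)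
    (hx' : x' ∈ E₁) (hy : y ∈ E₂) (hy' : y' ∈ E₂) (hz : z ∈ Icc hbot htop)
    (hz' : z' ∈ Icc hbot htop) {L : ℝ} (hL : X.dist (X.pt x y z) (X.pt x' y' z') ≤ L) :
    X'.dist (X'.pt (f x) (g y) (q z)) (X'.pt (f x') (g y') (q z')) ≤ 2 * Δ + κ * L + C := by
  have h1 := P.close x hx y hy z hz
  have h2 := P.close x' hx' y' hy' z' hz'
  have h3 := (P.quasi.1 (X.pt x y z) (X.pt x' y' z')).2
  have h4 := H'.dist_triangle (X'.pt (f x) (g y) (q z)) (φ (X.pt x y z))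
    (X'.pt (f x') (g y') (q z'))
  have h5 := H'.dist_triangle (φ (X.pt x y z)) (φ (X.pt x' y' z')) (X'.pt (f x') (g y') (q z'))
  rw [H'.dist_comm (X'.pt (f x) (g y) (q z)) (φ (X.pt x y z))] at h4
  have h6 := mul_le_mul_of_nonneg_left hL P.kappa_pos.le
  linarith

theorem abs_sub_le (P : IsNearProduct X X' κ C Δ E₁ E₂ hbot htop φ f g q)
    (H : X.IsCoarse c NL NU) (H' : X'.IsCoarse c' NL' NU') {z z' : ℝ} (hz : z ∈ Icc hbot htop)
    (hz' : z' ∈ Icc hbot htop) : |q z - q z'| ≤ 2 * Δ + κ * |z - z'| + C := by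
  obtain ⟨x, hx⟩ := P.nonempty_lower
  obtain ⟨y, hy⟩ := P.nonempty_upper
  exact (H'.abs_sub_le _ _ _ _ _ _).trans (P.dist_le H' hx hx hy hy hz hz' (H.dist_vert x y z z'))

/-- Points over `x` and `x'` at height `z` are within `c`, so their images under the product map are
within `2Δ + κc + C`, and both images have height `q z`. Any `y ∈ E₂` serves as the common upper
coordinate. -/
theorem nl_image (P : IsNearProduct X X' κ C Δ E₁ E₂ hbot htop φ f g q)
    (H : X.IsCoarse c NL NU) (H' : X'.IsCoarse c' NL' NU') {z : ℝ} (hz : z ∈ Icc hbot htop)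
    {x x' : X.Lower} (hx : x ∈ E₁) (hx' : x' ∈ E₁) (h : NL z x x') :
    NL' (q z + c' * (2 * Δ + κ * c + C + 1)) (f x) (f x') := by
  obtain ⟨y, hy⟩ := P.nonempty_upper
  exact H'.nl_of_dist _ _ _ _ _ _ _ (P.dist_le H' hx hx' hy hy hz hz (H.dist_lower x x' y z h))

theorem nu_image (P : IsNearProduct X X' κ C Δ E₁ E₂ hbot htop φ f g q)
    (H : X.IsCoarse c NL NU) (H' : X'.IsCoarse c' NL' NU') {z : ℝ} (hz : z ∈ Icc hbot htop)
    {y y' : X.Upper} (hy : y ∈ E₂) (hy' : y' ∈ E₂) (h : NU (-z) y y') :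
    NU' (-q z + c' * (2 * Δ + κ * c + C + 1)) (g y) (g y') := by
  obtain ⟨x, hx⟩ := P.nonempty_lower
  exact H'.nu_of_dist _ _ _ _ _ _ _ (P.dist_le H' hx hx hy hy' hz hz (H.dist_upper x y y' z h))

/-- Cover `E₁` by balls at height `z`. Their number is about `|SX| e^{-Bz}` because thickening a
wide set below the top of the box costs only a constant factor, and each has image at scale `q z`.
-/
theorem measure_thick_lower_le (P : IsNearProduct X X' κ C Δ E₁ E₂ hbot htop φ f g q)
    (H : X.IsCoarse c NL NU) (H' : X'.IsCoarse c' NL' NU') {z e θ : ℝ} (hz : z ∈ Icc hbot htop)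
    (he : c' * (2 * Δ + κ * c + C + 1) ≤ e) {SX : Set X.Lower} (hE : E₁ ⊆ SX)
    (hS : IsWide X.lowerMeasure NL c htop θ SX) :
    X'.lowerMeasure (thick NL' (q z + e) (f '' E₁)) ≤ ENNReal.ofReal
      (c ^ 2 * c' * Real.exp (X.branching * c + X'.branching * c') *
        ((X.lowerMeasure SX).toReal * Real.exp (X'.branching * (q z + e) - X.branching * z))) := by
  have := H.sigmaFiniteL
  refine H.scaleL.measure_thick_image_le_mul_exp H'.scaleL f E₁ z (q z + e) _
    (fun x hx y hy h => H'.scaleL.mono (by linarith) (P.nl_image H H' hz hx hy h)) ?_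
  refine (measure_mono (H.scaleL.thick_mono (by linarith [hz.2, H.pos]) hE)).trans
    (hS.thick_le.trans (le_of_eq ?_))
  rw [ENNReal.ofReal_mul H.pos.le, ENNReal.ofReal_toReal hS.lt_top.ne]

/-- The upper counterpart, with heights negated; it is needed for every subset `F` of `E₂`, with a
bound in terms of the whole of `SY`. -/
theorem measure_thick_upper_le (P : IsNearProduct X X' κ C Δ E₁ E₂ hbot htop φ f g q)
    (H : X.IsCoarse c NL NU) (H' : X'.IsCoarse c' NL' NU') {z e θ : ℝ} (hz : z ∈ Icc hbot htop)
    (he : c' * (2 * Δ + κ * c + C + 1) ≤ e) {SY : Set X.Upper} (hE : E₂ ⊆ SY)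
    (hS : IsWide X.upperMeasure NU c (-hbot) θ SY) {F : Set X.Upper} (hF : F ⊆ E₂) :
    X'.upperMeasure (thick NU' (-q z + e) (g '' F)) ≤ ENNReal.ofReal
      (c ^ 2 * c' * Real.exp (X.branching * c + X'.branching * c') *
        ((X.upperMeasure SY).toReal *
          Real.exp (X'.branching * (-q z + e) + X.branching * z))) := by
  have := H.sigmaFiniteU
  have key := H.scaleU.measure_thick_image_le_mul_exp H'.scaleU g F (-z) (-q z + e)
    (X.upperMeasure SY).toReal
    (fun x hx y hy h => H'.scaleU.mono (by linarith) (P.nu_image H H' hz (hF hx) (hF hy) h)) (by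
      refine (measure_mono (H.scaleU.thick_mono (by linarith [hz.1, H.pos]) (hF.trans hE))).trans
        (hS.thick_le.trans (le_of_eq ?_))
      rw [ENNReal.ofReal_mul H.pos.le, ENNReal.ofReal_toReal hS.lt_top.ne])
  rwa [mul_neg, sub_neg_eq_add] at key

/-- Points near the image of a point of the good set have coordinates near those of its image under
the product map. -/
theorem coord_near (P : IsNearProduct X X' κ C Δ E₁ E₂ hbot htop φ f g q)
    (H' : X'.IsCoarse c' NL' NU') {x : X.Lower} {y : X.Upper} {z : ℝ} (hx : x ∈ E₁) (hy : y ∈ E₂)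
    (hz : z ∈ Icc hbot htop) {v : X'.Coord} {ρ : ℝ}
    (hv : X'.dist (φ (X.pt x y z)) (X'.ofCoord v) ≤ ρ) :
    |v.2 - q z| ≤ Δ + ρ ∧ NL' (v.2 + c' * (Δ + ρ + 1)) (f x) v.1.1 ∧
      NU' (-v.2 + c' * (Δ + ρ + 1)) (g y) v.1.2 := by
  have h : X'.dist (X'.pt v.1.1 v.1.2 v.2) (X'.pt (f x) (g y) (q z)) ≤ Δ + ρ := by
    have h1 := H'.dist_triangle (X'.ofCoord v) (φ (X.pt x y z)) (X'.pt (f x) (g y) (q z))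
    rw [H'.dist_comm (X'.ofCoord v) (φ (X.pt x y z))] at h1
    have h2 := P.close x hx y hy z hz
    exact h1.trans ((add_le_add hv h2).trans (by linarith))
  exact ⟨(H'.abs_sub_le _ _ _ _ _ _).trans h, H'.scaleL.symm (H'.nl_of_dist _ _ _ _ _ _ _ h),
    H'.scaleU.symm (H'.nu_of_dist _ _ _ _ _ _ _ h)⟩

end IsNearProduct

/-- The total error in heights made in the comparison of a slab of thickness `w` with its image. -/
noncomputable def heightError (κ C c c' Δ w : ℝ) : ℝ :=
  3 * Δ + κ * w + C + (2 * c' + 1) +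
    c' * (2 * Δ + κ * c + 3 * C + (2 * c' + 1) + κ * (2 * c + 1) + 2)

theorem ofReal_mul_le_coordMeasure (H : X.IsCoarse c NL NU) {A : Set X.Lower} {A' : Set X.Upper}
    {a a' : ℝ} (ha : 0 ≤ a) (ha' : 0 ≤ a') (hA : ENNReal.ofReal a ≤ X.lowerMeasure A)
    (hA' : ENNReal.ofReal a' ≤ X.upperMeasure A') (z w : ℝ) :
    ENNReal.ofReal (a * a' * w) ≤ X.coordMeasure ((A ×ˢ A') ×ˢ Icc z (z + w)) := by
  rw [H.coordMeasure_prod, Real.volume_Icc, add_sub_cancel_left,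
    ENNReal.ofReal_mul (mul_nonneg ha ha'), ENNReal.ofReal_mul ha]
  gcongr

end

end ModelSpace

/-! ### Comparison of heights by flowing a slab in the target -/

/-- A fraction `θ` is lost to the complement of `E` and another to the edge of `S`, so `θ ≤ 1/4`
leaves half. Staying away from the edge is what keeps the flowed slab inside the box. -/
theorem IsWide.exists_interior {α : Type*} [MeasurableSpace α] {μ : Measure α}
    {N : ℝ → α → α → Prop} {c t θ : ℝ} {S E : Set α} (hS : IsWide μ N c t θ S)
    (hE : μ (S \ E) ≤ ENNReal.ofReal θ * μ S) (hθ0 : 0 ≤ θ) (hθ : θ ≤ 1 / 4) :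
    ∃ E' ⊆ E, ENNReal.ofReal ((μ S).toReal / 2) ≤ μ E' ∧ ∀ x ∈ E', ∀ x', N t x x' → x' ∈ S := by
  obtain ⟨S', hS'S, hm, hS'⟩ := hS.interior
  refine ⟨E ∩ S', inter_subset_left, ?_, fun x hx => hS' x hx.2⟩
  have h1 : μ S ≤ μ (E ∩ S') + μ (S \ E) + μ (S \ S') := by
    refine (measure_mono (t := (E ∩ S') ∪ (S \ E) ∪ (S \ S')) fun x hx => ?_).trans
      ((measure_union_le _ _).trans (add_le_add_left (measure_union_le _ _) _))
    by_cases h : x ∈ E <;> by_cases h' : x ∈ S' <;> simp [hx, h, h']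
  by_cases htop : μ (E ∩ S') = ⊤
  · rw [htop]; exact le_top
  have hfin := hS.lt_top.ne
  rw [ENNReal.ofReal_le_iff_le_toReal htop]
  have h2 : μ S ≤ μ (E ∩ S') + ENNReal.ofReal θ * μ S + ENNReal.ofReal θ * μ S :=
    h1.trans (by gcongr)
  have h3 := ENNReal.toReal_mono (by finiteness) h2
  rw [ENNReal.toReal_add (by finiteness) (by finiteness),
    ENNReal.toReal_add (by finiteness) (by finiteness), ENNReal.toReal_mul,
    ENNReal.toReal_ofReal hθ0] at h3
  have h4 : 0 ≤ (μ S).toReal := ENNReal.toReal_nonneg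
  nlinarith

namespace ModelSpace

variable {X X' : ModelSpace} {κ C : ℝ} {φ : X.Pt → X'.Pt}
  {c c' Δ hbot htop : ℝ} {NL : ℝ → X.Lower → X.Lower → Prop}
  {NU : ℝ → X.Upper → X.Upper → Prop} {NL' : ℝ → X'.Lower → X'.Lower → Prop}
  {NU' : ℝ → X'.Upper → X'.Upper → Prop} {E₁ : Set X.Lower} {E₂ : Set X.Upper}
  {f : X.Lower → X'.Lower} {g : X.Upper → X'.Upper} {q : ℝ → ℝ}

/-- Vertical translation distorts distances exponentially but preserves the product measure. -/
theorem IsCoarse.coordMeasure_shift (H : X.IsCoarse c NL NU) (s : ℝ) (V : Set X.Coord) :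
    X.coordMeasure {v | (v.1, v.2 - s) ∈ V} = X.coordMeasure V := by
  have := H.sigmaFiniteL
  have := H.sigmaFiniteU
  let T : X.Coord ≃ᵐ X.Coord := (MeasurableEquiv.refl _).prodCongr (MeasurableEquiv.subRight s)
  have hT : MeasurePreserving T X.coordMeasure X.coordMeasure :=
    (MeasurePreserving.id _).prod (measurePreserving_sub_right volume s)
  exact hT.measure_preimage_equiv V

namespace IsNearProduct

/-- How far from the top and the bottom of the box one has to be in the comparison of heights at
distance `l`. -/
noncomputable def margin (κ C c c' Δ l : ℝ) : ℝ :=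
  c * (κ * ((2 * c' + 1) + (2 * Δ + κ * l + C) + 2 * C) + (2 * c + 1) + 1)

/-- Flowing up in the target a slab of the source at height `z₁` to the height `q z₂`. -/
theorem width_le (P : IsNearProduct X X' κ C Δ E₁ E₂ hbot htop φ f g q)
    (H : X.IsCoarse c NL NU) (H' : X'.IsCoarse c' NL' NU') {MA MB : ℝ} (hMA : 0 < MA)
    (hMB : 0 < MB)
    (hA : ∀ φ : X.Pt → X'.Pt, X.IsQuasiIsometry X' κ C φ → ∀ W : Set X.Coord,
      X.coordMeasure W ≤ ENNReal.ofReal MA *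
        X'.coordMeasure {v | ∃ w ∈ W, X'.dist (φ (X.ofCoord w)) (X'.ofCoord v) ≤ 2 * c' + 1})
    (hB : ∀ φ : X.Pt → X'.Pt, X.IsQuasiIsometry X' κ C φ → ∀ ψ : X'.Coord → X.Pt,
      (∀ v, X'.dist (φ (ψ v)) (X'.ofCoord v) ≤ C) → ∀ V : Set X'.Coord,
      X'.coordMeasure V ≤ ENNReal.ofReal MB *
        X.coordMeasure {w | ∃ v ∈ V, X.dist (ψ v) (X.ofCoord w) ≤ 2 * c + 1})
    {θ : ℝ} (hθ0 : 0 ≤ θ) (hθ : θ ≤ 1 / 4) {SX : Set X.Lower} {SY : Set X.Upper}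
    (hSX : IsWide X.lowerMeasure NL c htop θ SX) (hSY : IsWide X.upperMeasure NU c (-hbot) θ SY)
    (hE₁ : E₁ ⊆ SX) (hE₂ : E₂ ⊆ SY)
    (hm₁ : X.lowerMeasure (SX \ E₁) ≤ ENNReal.ofReal θ * X.lowerMeasure SX)
    (hm₂ : X.upperMeasure (SY \ E₂) ≤ ENNReal.ofReal θ * X.upperMeasure SY)
    {z₁ z₂ w e : ℝ} (hw : 0 ≤ w) (hz₂ : z₂ ∈ Icc hbot htop)
    (hbot₁ : hbot + margin κ C c c' Δ |z₂ - z₁| ≤ z₁)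
    (htop₁ : z₁ + w + margin κ C c c' Δ |z₂ - z₁| ≤ htop)
    (he : heightError κ C c c' Δ w ≤ e) :
    w / 4 ≤ 2 * MA * MB * θ * (htop - hbot) +
      2 * MA * (c ^ 2 * c' * Real.exp (X.branching * c + X'.branching * c')) ^ 2 * e *
        Real.exp (X.branching * (z₂ - z₁) - X'.branching * (q z₂ - q z₁) +
          2 * X'.branching * e) := by
  have hc := H.pos
  have hc1 := H.one_le
  have hc' := H'.pos
  have hκ := P.kappa_pos
  have hC := P.C_nonneg
  have hΔ := P.delta_nonneg
  have hqi := P.quasi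
  obtain ⟨D₁, hD₁, hD₁m, hD₁S⟩ := hSX.exists_interior hm₁ hθ0 hθ
  obtain ⟨D₂, hD₂, hD₂m, hD₂S⟩ := hSY.exists_interior hm₂ hθ0 hθ
  have hex : ∀ v : X'.Coord, ∃ p, X'.dist (φ p) (X'.ofCoord v) ≤ C := fun v => hqi.2 _
  choose ψ hψ using hex
  have hl : 0 ≤ |z₂ - z₁| := abs_nonneg _
  set m := margin κ C c c' Δ |z₂ - z₁| with hm
  have hm0 : 0 ≤ m := by rw [hm, margin]; positivity
  have hz₁ : z₁ ∈ Icc hbot htop := ⟨by linarith, by linarith⟩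
  set s := q z₂ - q z₁ with hs
  have hsabs : |s| ≤ 2 * Δ + κ * |z₂ - z₁| + C := P.abs_sub_le H H' hz₂ hz₁
  set sX := (X.lowerMeasure SX).toReal with hsX
  set sY := (X.upperMeasure SY).toReal with hsY
  have hsX0 : 0 < sX := ENNReal.toReal_pos hSX.pos.ne' hSX.lt_top.ne
  have hsY0 : 0 < sY := ENNReal.toReal_pos hSY.pos.ne' hSY.lt_top.ne
  have hsXe : X.lowerMeasure SX = ENNReal.ofReal sX := (ENNReal.ofReal_toReal hSX.lt_top.ne).symm
  have hsYe : X.upperMeasure SY = ENNReal.ofReal sY := (ENNReal.ofReal_toReal hSY.lt_top.ne).symm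
  set M₁ := c ^ 2 * c' * Real.exp (X.branching * c + X'.branching * c') with hM₁
  have hM₁0 : 0 < M₁ := by positivity
  set W : Set X.Coord := (D₁ ×ˢ D₂) ×ˢ Icc z₁ (z₁ + w)
  have hW : ENNReal.ofReal (sX / 2 * (sY / 2) * w) ≤ X.coordMeasure W :=
    ofReal_mul_le_coordMeasure H (by positivity) (by positivity) hD₁m hD₂m z₁ w
  set V : Set X'.Coord := {v | ∃ w ∈ W, X'.dist (φ (X.ofCoord w)) (X'.ofCoord v) ≤ 2 * c' + 1}
  -- The image of the slab translated by `s`, so that it lies near height `q z₂`.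
  set V' : Set X'.Coord := {v | (v.1, v.2 - s) ∈ V}
  set G : Set X.Pt := {p | ∃ x ∈ E₁, ∃ y ∈ E₂, ∃ z ∈ Icc hbot htop,
    X.dist p (X.pt x y z) ≤ 2 * c + 1}
  have hV : X.coordMeasure W ≤ ENNReal.ofReal MA * X'.coordMeasure V' := by
    rw [H'.coordMeasure_shift]; exact hA φ hqi W
  -- the points of the flowed slab that come from outside the good set
  have hbad : X'.coordMeasure {v ∈ V' | ψ v ∉ G} ≤
      ENNReal.ofReal (MB * (2 * θ * (sX * sY * (htop - hbot)))) := by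
    refine (hB φ hqi ψ hψ _).trans ?_
    rw [ENNReal.ofReal_mul hMB.le]
    gcongr
    have hsub : {w | ∃ v ∈ {v ∈ V' | ψ v ∉ G}, X.dist (ψ v) (X.ofCoord w) ≤ 2 * c + 1} ⊆
        (((SX \ E₁) ×ˢ SY) ×ˢ Icc hbot htop) ∪ ((SX ×ˢ (SY \ E₂)) ×ˢ Icc hbot htop) := by
      rintro ⟨⟨x', y'⟩, z'⟩ ⟨v, ⟨⟨⟨⟨x, y⟩, z⟩, ⟨⟨hx, hy⟩, hz⟩, hwv⟩, hvG⟩, hd⟩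
      simp only [ofCoord] at hx hy hz hwv hd
      have hd1 : X'.dist (φ (X.pt x y z)) (φ (ψ v)) ≤
          (2 * c' + 1) + (2 * Δ + κ * |z₂ - z₁| + C) + C := by
        have t1 := H'.dist_triangle (φ (X.pt x y z)) (X'.pt v.1.1 v.1.2 (v.2 - s)) (φ (ψ v))
        have t2 := H'.dist_triangle (X'.pt v.1.1 v.1.2 (v.2 - s)) (X'.pt v.1.1 v.1.2 v.2) (φ (ψ v))
        have t3 := H'.dist_vert v.1.1 v.1.2 (v.2 - s) v.2
        rw [sub_sub_cancel_left, abs_neg] at t3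
        have t4 := hψ v
        rw [H'.dist_comm] at t4
        simp only [ofCoord] at t4
        linarith
      have hd2 := hqi.dist_le hκ hd1
      have hd3 := H.dist_triangle (X.pt x y z) (ψ v) (X.pt x' y' z')
      have hd4 : X.dist (X.pt x y z) (X.pt x' y' z') ≤
          κ * ((2 * c' + 1) + (2 * Δ + κ * |z₂ - z₁| + C) + 2 * C) + (2 * c + 1) :=
        hd3.trans ((add_le_add hd2 hd).trans (le_of_eq (by ring)))
      -- The displacement bound `hd4` changes the lower coordinate at scale at most `z + m ≤ htop`,
      -- the scale at which `D₁` is interior to `SX`. The upper coordinate is symmetric, with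
      -- `-hbot`.
      have hx' : x' ∈ SX := hD₁S x hx x' (H.scaleL.mono (by
        have : z + m ≤ htop := by linarith [hz.2]
        exact this) (H.nl_of_dist _ _ _ _ _ _ _ hd4))
      have hy' : y' ∈ SY := hD₂S y hy y' (H.scaleU.mono (by
        have : -z + m ≤ -hbot := by linarith [hz.1]
        exact this) (H.nu_of_dist _ _ _ _ _ _ _ hd4))
      have hz' : z' ∈ Icc hbot htop := by
        have h1 := abs_le.1 ((H.abs_sub_le _ _ _ _ _ _).trans hd4)
        have h2 : κ * ((2 * c' + 1) + (2 * Δ + κ * |z₂ - z₁| + C) + 2 * C) + (2 * c + 1) ≤ m := by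
          rw [hm, margin]
          have : 0 ≤ κ * ((2 * c' + 1) + (2 * Δ + κ * |z₂ - z₁| + C) + 2 * C) + (2 * c + 1) := by
            positivity
          nlinarith
        constructor <;> linarith [h1.1, h1.2, hz.1, hz.2]
      by_cases h1 : x' ∈ E₁
      · by_cases h2 : y' ∈ E₂
        · exact absurd ⟨x', h1, y', h2, z', hz', hd⟩ hvG
        · exact Or.inr ⟨⟨hx', hy', h2⟩, hz'⟩
      · exact Or.inl ⟨⟨⟨hx', h1⟩, hy'⟩, hz'⟩
    refine (measure_mono hsub).trans ((measure_union_le _ _).trans ?_)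
    rw [H.coordMeasure_prod, H.coordMeasure_prod, Real.volume_Icc, hsYe, hsXe]
    rw [hsXe] at hm₁
    rw [hsYe] at hm₂
    have hh : 0 ≤ htop - hbot := by linarith [hz₁.1, hz₁.2]
    calc _ ≤ ENNReal.ofReal θ * ENNReal.ofReal sX * ENNReal.ofReal sY *
          ENNReal.ofReal (htop - hbot) + ENNReal.ofReal sX *
          (ENNReal.ofReal θ * ENNReal.ofReal sY) * ENNReal.ofReal (htop - hbot) := by gcongr
      _ = _ := by
          rw [← ENNReal.ofReal_mul (by positivity), ← ENNReal.ofReal_mul (by positivity),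
            ← ENNReal.ofReal_mul (by positivity), ← ENNReal.ofReal_mul (by positivity),
            ← ENNReal.ofReal_mul (by positivity), ← ENNReal.ofReal_mul (by positivity),
            ← ENNReal.ofReal_add (by positivity) (by positivity)]
          congr 1; ring
  have hκw : 0 ≤ κ * w := by positivity
  have hκc : 0 ≤ κ * c := by positivity
  -- the other points of the flowed slab
  have hgoodsub : {v ∈ V' | ψ v ∈ G} ⊆ (thick NL' (q z₁ + e) (f '' E₁) ×ˢ
      thick NU' (-q z₂ + e) (g '' E₂)) ×ˢ Icc (q z₂ - e) (q z₂ + e) := by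
    rintro v ⟨⟨⟨⟨x, y⟩, z⟩, ⟨⟨hx, hy⟩, hz⟩, hwv⟩, x', hx', y', hy', z', hz', hd⟩
    simp only [ofCoord] at hx hy hz hwv
    have hzI : z ∈ Icc hbot htop := ⟨by linarith [hz.1], by linarith [hz.2]⟩
    -- The lower coordinate of `v` is read off before the translation, hence at the scale of `q z₁`;
    -- below, `n3` reads the upper coordinate after it, at the scale of `q z₂`. This mismatch
    -- produces the exponential of the height difference.
    obtain ⟨n1, n2, -⟩ := P.coord_near H' (hD₁ hx) (hD₂ hy) hzI (v := (v.1, v.2 - s)) hwv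
    have hq := P.abs_sub_le H H' hzI hz₁
    have hzw : |z - z₁| ≤ w := by rw [abs_le]; constructor <;> linarith [hz.1, hz.2]
    have hκz : κ * |z - z₁| ≤ κ * w := by gcongr
    have hv2 : X'.dist (φ (X.pt x' y' z')) (X'.ofCoord v) ≤ κ * (2 * c + 1) + 2 * C := by
      have t1 := H'.dist_triangle (φ (X.pt x' y' z')) (φ (ψ v)) (X'.ofCoord v)
      have t2 := (hqi.1 (X.pt x' y' z') (ψ v)).2
      rw [H.dist_comm] at t2
      have t3 := hψ v
      have t4 := mul_le_mul_of_nonneg_left hd hκ.le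
      linarith
    obtain ⟨-, -, n3⟩ := P.coord_near H' hx' hy' hz' hv2
    simp only at n1 n2
    have hdiff : |v.2 - q z₂| ≤ 3 * Δ + κ * w + C + (2 * c' + 1) := by
      have : v.2 - q z₂ = (v.2 - s - q z) + (q z - q z₁) := by rw [hs]; ring
      rw [this]
      refine (abs_add_le _ _).trans ?_
      linarith
    have hdiff' := abs_le.1 hdiff
    rw [heightError] at he
    have hpos : 0 ≤ 2 * Δ + κ * c + 3 * C + (2 * c' + 1) + κ * (2 * c + 1) + 2 := by positivity
    have hposc := mul_nonneg hc'.le hpos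
    have ha1 : c' * (Δ + (2 * c' + 1) + 1) ≤ c' * (2 * Δ + κ * c + 3 * C + (2 * c' + 1) +
        κ * (2 * c + 1) + 2) := mul_le_mul_of_nonneg_left (by nlinarith) hc'.le
    have ha2 : c' * (Δ + (κ * (2 * c + 1) + 2 * C) + 1) ≤ c' * (2 * Δ + κ * c + 3 * C +
        (2 * c' + 1) + κ * (2 * c + 1) + 2) := mul_le_mul_of_nonneg_left (by linarith) hc'.le
    refine ⟨⟨⟨f x, mem_image_of_mem _ (hD₁ hx), H'.scaleL.mono ?_ n2⟩,
      ⟨g y', mem_image_of_mem _ hy', H'.scaleU.mono ?_ n3⟩⟩, ?_, ?_⟩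
    · linarith [hdiff'.2]
    · linarith [hdiff'.1]
    · linarith [hdiff'.1]
    · linarith [hdiff'.2]
  have he0 : c' * (2 * Δ + κ * c + C + 1) ≤ e := by
    rw [heightError] at he
    have : c' * (2 * Δ + κ * c + C + 1) ≤ c' * (2 * Δ + κ * c + 3 * C +
        (2 * c' + 1) + κ * (2 * c + 1) + 2) := mul_le_mul_of_nonneg_left (by nlinarith) hc'.le
    linarith
  have he' : 0 ≤ e := le_trans (by positivity) he0
  have hgood : X'.coordMeasure {v ∈ V' | ψ v ∈ G} ≤ ENNReal.ofReal
      (M₁ ^ 2 * (sX * sY) * (2 * e) * Real.exp (X.branching * (z₂ - z₁) -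
        X'.branching * s + 2 * X'.branching * e)) := by
    refine (measure_mono hgoodsub).trans ?_
    rw [H'.coordMeasure_prod, Real.volume_Icc]
    refine (mul_le_mul' (mul_le_mul' (P.measure_thick_lower_le H H' hz₁ he0 hE₁ hSX)
      (P.measure_thick_upper_le H H' hz₂ he0 hE₂ hSY le_rfl)) le_rfl).trans (le_of_eq ?_)
    rw [← hsX, ← hsY, ← hM₁, ← ENNReal.ofReal_mul (by positivity),
      ← ENNReal.ofReal_mul (by positivity)]
    congr 1
    rw [show X.branching * (z₂ - z₁) - X'.branching * s + 2 * X'.branching * e =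
      (X'.branching * (q z₁ + e) - X.branching * z₁) +
      (X'.branching * (-q z₂ + e) + X.branching * z₂) by rw [hs]; ring,
      Real.exp_add (X'.branching * (q z₁ + e) - X.branching * z₁)]
    ring
  have hh : 0 ≤ htop - hbot := by linarith [hz₁.1, hz₁.2]
  have htotal : ENNReal.ofReal (sX / 2 * (sY / 2) * w) ≤ ENNReal.ofReal (MA *
      (M₁ ^ 2 * (sX * sY) * (2 * e) * Real.exp (X.branching * (z₂ - z₁) -
        X'.branching * s + 2 * X'.branching * e) + MB * (2 * θ * (sX * sY * (htop - hbot))))) := by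
    refine hW.trans (hV.trans ?_)
    rw [ENNReal.ofReal_mul hMA.le, ENNReal.ofReal_add (by positivity) (by positivity)]
    gcongr
    refine (measure_mono (t := {v ∈ V' | ψ v ∈ G} ∪ {v ∈ V' | ψ v ∉ G}) fun v hv => ?_).trans
      ((measure_union_le _ _).trans (add_le_add hgood hbad))
    by_cases h : ψ v ∈ G
    · exact Or.inl ⟨hv, h⟩
    · exact Or.inr ⟨hv, h⟩
  have hreal := (ENNReal.ofReal_le_ofReal_iff (by positivity)).1 htotal
  have hss : 0 < sX * sY := by positivity
  -- Every term is proportional to `|SX||SY|`, so the size of the base of the box drops out.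
  refine le_of_mul_le_mul_left (a := sX * sY) ?_ hss
  refine le_trans (le_of_eq (by ring)) (hreal.trans (le_of_eq (by ring)))

end IsNearProduct

end ModelSpace

/-! ### The constant term: size of the coarsened image -/

/-- The complement of a subset of almost full measure. -/
theorem measure_diff_le_of_ofReal_mul_le {α : Type*} [MeasurableSpace α] {μ : Measure α}
    {S E : Set α} (hE : MeasurableSet E) (hES : E ⊆ S) (hS : μ S ≠ ⊤) {t : ℝ}
    (h : ENNReal.ofReal (1 - t) * μ S ≤ μ E) : μ (S \ E) ≤ ENNReal.ofReal t * μ S := by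
  rw [measure_sdiff hES hE.nullMeasurableSet (measure_ne_top_of_subset hES hS), tsub_le_iff_right]
  calc μ S = ENNReal.ofReal (t + (1 - t)) * μ S := by simp
    _ ≤ (ENNReal.ofReal t + ENNReal.ofReal (1 - t)) * μ S := by gcongr; exact ENNReal.ofReal_add_le
    _ ≤ _ := by rw [add_mul]; gcongr

/-- Taking logarithms in an estimate up to a constant factor. -/
theorem neg_le_log_div_of_le_mul_exp {a b u : ℝ} (ha : 0 < a) (h : a ≤ b * Real.exp u) :
    -u ≤ Real.log (b / a) := by
  have hb : 0 < b := pos_of_mul_pos_left (ha.trans_le h) (Real.exp_pos u).le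
  rw [← Real.exp_le_exp, Real.exp_log (by positivity), Real.exp_neg, le_div_iff₀ ha,
    inv_mul_le_iff₀ (Real.exp_pos u), mul_comm]
  exact h

namespace ModelSpace

variable {X X' : ModelSpace} {κ C : ℝ} {φ : X.Pt → X'.Pt}
  {c c' Δ hbot htop : ℝ} {NL : ℝ → X.Lower → X.Lower → Prop}
  {NU : ℝ → X.Upper → X.Upper → Prop} {NL' : ℝ → X'.Lower → X'.Lower → Prop}
  {NU' : ℝ → X'.Upper → X'.Upper → Prop} {E₁ : Set X.Lower} {E₂ : Set X.Upper}
  {f : X.Lower → X'.Lower} {g : X.Upper → X'.Upper} {q : ℝ → ℝ}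

theorem IsCoarse.coarsenUpper_subset (H : X.IsCoarse c NL NU) (z : ℝ) (F : Set X.Upper) :
    X.coarsenUpper z F ⊆ thick NU (-z) F :=
  fun _ ⟨y', hy', h⟩ => ⟨y', hy', H.scaleU.symm (H.nu_of_lt _ _ _ h)⟩

/-- The unit of scale given up pays for the strict inequality in the definition of the coarsening.
-/
theorem IsCoarse.subset_coarsenUpper (H : X.IsCoarse c NL NU) (z : ℝ) (F : Set X.Upper) :
    thick NU (-z - 1) F ⊆ X.coarsenUpper z F :=
  fun _ ⟨y', hy', h⟩ => ⟨y', hy', H.lt_hMinus _ _ _ (H.scaleU.symm h)⟩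

namespace IsNearProduct

theorem heightError_ge (P : IsNearProduct X X' κ C Δ E₁ E₂ hbot htop φ f g q) (hc : 0 < c)
    (hc' : 1 ≤ c') {w e : ℝ} (hw : 0 ≤ w) (he : heightError κ C c c' Δ w ≤ e) :
    c' ≤ e ∧ c' * (2 * Δ + κ * c + C + 1) ≤ e ∧
      3 * Δ + κ * w + C + (2 * c' + 1) + c' * (Δ + (2 * c' + 1) + 1) ≤ e := by
  have hκ := P.kappa_pos
  have hC := P.C_nonneg
  have hΔ := P.delta_nonneg
  have hκw : 0 ≤ κ * w := by positivity
  have hκc : 0 ≤ κ * c := by positivity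
  rw [heightError] at he
  have h2 : c' * (2 * Δ + κ * c + C + 1) ≤ c' * (2 * Δ + κ * c + 3 * C + (2 * c' + 1) +
      κ * (2 * c + 1) + 2) := mul_le_mul_of_nonneg_left (by nlinarith) (by linarith)
  have h3 : c' * (Δ + (2 * c' + 1) + 1) ≤ c' * (2 * Δ + κ * c + 3 * C + (2 * c' + 1) +
      κ * (2 * c + 1) + 2) := mul_le_mul_of_nonneg_left (by nlinarith) (by linarith)
  have h4 : 0 ≤ c' * (2 * Δ + κ * c + 3 * C + (2 * c' + 1) + κ * (2 * c + 1) + 2) := by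
    positivity
  exact ⟨by linarith, by linarith, by linarith⟩

/-- The upper half of the constant term: the coarsening sits in a thickening at scale `-q z + e`,
which the covering of `F` at height `z` controls. -/
theorem measure_coarsenUpper_le (P : IsNearProduct X X' κ C Δ E₁ E₂ hbot htop φ f g q)
    (H : X.IsCoarse c NL NU) (H' : X'.IsCoarse c' NL' NU') {z w e θ : ℝ} (hz : z ∈ Icc hbot htop)
    (hw : 0 ≤ w) (he : heightError κ C c c' Δ w ≤ e) {SY : Set X.Upper} (hE : E₂ ⊆ SY)
    (hS : IsWide X.upperMeasure NU c (-hbot) θ SY) {F : Set X.Upper} (hF : F ⊆ E₂) :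
    X'.upperMeasure (X'.coarsenUpper (q z) (g '' F)) ≤ ENNReal.ofReal
      (c ^ 2 * c' * Real.exp (X.branching * c + X'.branching * c') *
        ((X.upperMeasure SY).toReal *
          Real.exp (X'.branching * (-q z + e) + X.branching * z))) := by
  obtain ⟨h1, h2, -⟩ := P.heightError_ge H.pos H'.one_le hw he
  exact (measure_mono ((H'.coarsenUpper_subset _ _).trans
    (H'.scaleU.thick_mono (by linarith [H'.pos]) le_rfl))).trans
    (P.measure_thick_upper_le H H' hz h2 hE hS hF)

/-- The volume of the image of a slab bounds the coarsening of `g F` from below. -/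
theorem le_measure_coarsenUpper (P : IsNearProduct X X' κ C Δ E₁ E₂ hbot htop φ f g q)
    (H : X.IsCoarse c NL NU) (H' : X'.IsCoarse c' NL' NU') {MA : ℝ} (hMA : 0 < MA)
    (hA : ∀ φ : X.Pt → X'.Pt, X.IsQuasiIsometry X' κ C φ → ∀ W : Set X.Coord,
      X.coordMeasure W ≤ ENNReal.ofReal MA *
        X'.coordMeasure {v | ∃ w ∈ W, X'.dist (φ (X.ofCoord w)) (X'.ofCoord v) ≤ 2 * c' + 1})
    {θ : ℝ} {SX : Set X.Lower} {s : ℝ} (hs : 0 ≤ s)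
    (hSX : IsWide X.lowerMeasure NL c htop θ SX)
    (hE₁ : E₁ ⊆ SX)
    (hm₁ : ENNReal.ofReal ((X.lowerMeasure SX).toReal / 2) ≤ X.lowerMeasure E₁)
    {F : Set X.Upper} (hF : F ⊆ E₂) (hFm : ENNReal.ofReal (s / 2) ≤ X.upperMeasure F)
    {z₁ w e : ℝ} (hw : 0 ≤ w) (hz₁ : hbot ≤ z₁) (hz₁' : z₁ + w ≤ htop)
    (he : heightError κ C c c' Δ w ≤ e)
    (hfin : X'.upperMeasure (X'.coarsenUpper (q z₁) (g '' F)) ≠ ⊤) :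
    s * w / 4 ≤ MA * (c ^ 2 * c' * Real.exp (X.branching * c + X'.branching * c')) *
      (c' ^ 2 * Real.exp (X'.branching * (1 + c'))) * (2 * e) *
      Real.exp (X'.branching * q z₁ - X.branching * z₁ + 2 * X'.branching * e) *
      (X'.upperMeasure (X'.coarsenUpper (q z₁) (g '' F))).toReal := by
  have hc := H.pos
  have hc' := H'.pos
  have hκ := P.kappa_pos
  obtain ⟨he1, he0, hev⟩ := P.heightError_ge H.pos H'.one_le hw he
  have he' : 0 ≤ e := by linarith
  have := H'.sigmaFiniteU
  have hzI₁ : z₁ ∈ Icc hbot htop := ⟨hz₁, by linarith⟩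
  set sX := (X.lowerMeasure SX).toReal with hsX
  have hsX0 : 0 < sX := ENNReal.toReal_pos hSX.pos.ne' hSX.lt_top.ne
  set M₁ := c ^ 2 * c' * Real.exp (X.branching * c + X'.branching * c') with hM₁
  have hM₁0 : 0 < M₁ := by positivity
  set n := (X'.upperMeasure (X'.coarsenUpper (q z₁) (g '' F))).toReal with hn
  have hn0 : 0 ≤ n := ENNReal.toReal_nonneg
  set W : Set X.Coord := (E₁ ×ˢ F) ×ˢ Icc z₁ (z₁ + w)
  have hW : ENNReal.ofReal (sX / 2 * (s / 2) * w) ≤ X.coordMeasure W :=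
    ofReal_mul_le_coordMeasure H (by positivity) (by positivity) hm₁ hFm z₁ w
  have hsub : {v | ∃ w ∈ W, X'.dist (φ (X.ofCoord w)) (X'.ofCoord v) ≤ 2 * c' + 1} ⊆
      (thick NL' (q z₁ + e) (f '' E₁) ×ˢ thick NU' (-q z₁ + e) (g '' F)) ×ˢ
        Icc (q z₁ - e) (q z₁ + e) := by
    rintro v ⟨⟨⟨x, y⟩, z⟩, ⟨⟨hx, hy⟩, hz⟩, hwv⟩
    simp only [ofCoord] at hx hy hz hwv
    have hzI : z ∈ Icc hbot htop := ⟨by linarith [hz.1], by linarith [hz.2]⟩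
    obtain ⟨n1, n2, n3⟩ := P.coord_near H' hx (hF hy) hzI (v := v) hwv
    have hq := P.abs_sub_le H H' hzI hzI₁
    have hzw : |z - z₁| ≤ w := by rw [abs_le]; constructor <;> linarith [hz.1, hz.2]
    have hκz : κ * |z - z₁| ≤ κ * w := by gcongr
    have hdiff : |v.2 - q z₁| ≤ 3 * Δ + κ * w + C + (2 * c' + 1) := by
      have : v.2 - q z₁ = (v.2 - q z) + (q z - q z₁) := by ring
      rw [this]
      refine (abs_add_le _ _).trans ?_
      linarith
    have hdiff' := abs_le.1 hdiff
    have hpos : 0 ≤ c' * (Δ + (2 * c' + 1) + 1) := by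
      have := P.delta_nonneg
      positivity
    refine ⟨⟨⟨f x, mem_image_of_mem _ hx, H'.scaleL.mono ?_ n2⟩,
      ⟨g y, mem_image_of_mem _ hy, H'.scaleU.mono ?_ n3⟩⟩, ?_, ?_⟩
    · linarith [hdiff'.2]
    · linarith [hdiff'.1]
    · linarith [hdiff'.1]
    · linarith [hdiff'.2]
  have hthick : X'.upperMeasure (thick NU' (-q z₁ + e) (g '' F)) ≤
      ENNReal.ofReal (c' ^ 2 * Real.exp (X'.branching * (e + 1 + c')) * n) := by
    -- The volume argument controls the thickening at scale `-q z₁ + e`; going down to `-q z₁ - 1`,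
    -- which lies inside the coarsening, costs a factor `e^{B'(e + O(1))}`.
    have h := H'.scaleU.measure_thick_le_exp_mul (g '' F) (-q z₁ - 1) (e + 1) (by linarith)
    rw [show -q z₁ - 1 + (e + 1) = -q z₁ + e by ring] at h
    refine h.trans ?_
    rw [ENNReal.ofReal_mul (q := n) (by positivity), hn, ENNReal.ofReal_toReal hfin]
    gcongr
    exact H'.subset_coarsenUpper _ _
  have htotal : ENNReal.ofReal (sX / 2 * (s / 2) * w) ≤ ENNReal.ofReal (MA *
      (M₁ * (sX * Real.exp (X'.branching * (q z₁ + e) - X.branching * z₁)) *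
        (c' ^ 2 * Real.exp (X'.branching * (e + 1 + c')) * n) * (2 * e))) := by
    refine hW.trans ((hA φ P.quasi W).trans ?_)
    rw [ENNReal.ofReal_mul hMA.le]
    gcongr
    refine (measure_mono hsub).trans ?_
    rw [H'.coordMeasure_prod, Real.volume_Icc, ENNReal.ofReal_mul (by positivity),
      ENNReal.ofReal_mul (by positivity)]
    refine mul_le_mul' (mul_le_mul' (P.measure_thick_lower_le H H' hzI₁ he0 hE₁ hSX) hthick)
      (le_of_eq (by congr 1; ring))
  have hreal := (ENNReal.ofReal_le_ofReal_iff (by positivity)).1 htotal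
  have hexp : Real.exp (X'.branching * (1 + c')) *
      Real.exp (X'.branching * q z₁ - X.branching * z₁ + 2 * X'.branching * e) =
      Real.exp (X'.branching * (q z₁ + e) - X.branching * z₁) *
        Real.exp (X'.branching * (e + 1 + c')) := by
    rw [← Real.exp_add, ← Real.exp_add]; congr 1; ring
  refine le_of_mul_le_mul_left (a := sX) ?_ hsX0
  calc sX * (s * w / 4) = sX / 2 * (s / 2) * w := by ring
    _ ≤ _ := hreal
    _ = sX * (MA * M₁ * c' ^ 2 * (2 * e) * (Real.exp (X'.branching * (q z₁ + e) - X.branching * z₁) *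
        Real.exp (X'.branching * (e + 1 + c'))) * n) := by ring
    _ = _ := by rw [← hexp]; ring

end IsNearProduct

/-! ### Lower boundary points with good slices -/

/-- The points of the lower boundary on which most of a large subset of the box is visible. -/
theorem IsCoarse.exists_good_lower (H : X.IsCoarse c NL NU) {SX : Set X.Lower} {SY : Set X.Upper}
    {θ₁ : ℝ} (hSX : IsWide X.lowerMeasure NL c htop θ₁ SX)
    (hSY : IsWide X.upperMeasure NU c (-hbot) θ₁ SY) (hE₁ : E₁ ⊆ SX) (hE₂ : E₂ ⊆ SY)
    (hE₁m : MeasurableSet E₁) (hE₂m : MeasurableSet E₂) {θ : ℝ} (hθ : 0 < θ) (hh : hbot < htop)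
    {U : Set X.Pt} (hU : U ⊆ X.productSet E₁ E₂ hbot htop) (hUm : X.IsMeasurable U)
    (hUv : ENNReal.ofReal (1 - 128 * Real.sqrt θ) * X.vol (X.productSet E₁ E₂ hbot htop) ≤ X.vol U)
    (hm₁ : X.lowerMeasure (SX \ E₁) ≤ ENNReal.ofReal θ * X.lowerMeasure SX) :
    ∃ E ⊆ E₁, X.lowerMeasure (SX \ E) ≤
        ENNReal.ofReal (θ + 128 * √√θ) * X.lowerMeasure SX ∧
      ∀ x ∈ E, ∀ a d, 0 < d → hbot ≤ a → a + d ≤ htop → ∀ F : Set X.Upper,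
        (∀ y ∈ E₂, ∀ z ∈ Ioo a (a + d), X.pt x y z ∈ U → y ∈ F) →
        X.upperMeasure (E₂ \ F) ≤ ENNReal.ofReal (√√θ * c ^ 2 *
          ((htop - hbot) / d)) * X.upperMeasure SY := by
  have hc := H.pos
  have := H.sigmaFiniteL
  have := H.sigmaFiniteU
  set sX := (X.lowerMeasure SX).toReal with hsX
  set sY := (X.upperMeasure SY).toReal with hsY
  have hsX0 : 0 < sX := ENNReal.toReal_pos hSX.pos.ne' hSX.lt_top.ne
  have hsY0 : 0 < sY := ENNReal.toReal_pos hSY.pos.ne' hSY.lt_top.ne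
  have hsXe : X.lowerMeasure SX = ENNReal.ofReal sX := (ENNReal.ofReal_toReal hSX.lt_top.ne).symm
  have hsYe : X.upperMeasure SY = ENNReal.ofReal sY := (ENNReal.ofReal_toReal hSY.lt_top.ne).symm
  set τ := √√θ with hτ
  have hτ0 : 0 < τ := Real.sqrt_pos.2 (Real.sqrt_pos.2 hθ)
  have hτ2 : √θ = τ * τ := (Real.mul_self_sqrt (Real.sqrt_nonneg θ)).symm
  set h := htop - hbot with hhdef
  have hh0 : 0 < h := by rw [hhdef]; linarith
  set P : Set X.Coord := {w | X.pt w.1.1 w.1.2 w.2 ∈ X.productSet E₁ E₂ hbot htop} with hP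
  set U' : Set X.Coord := {w | X.pt w.1.1 w.1.2 w.2 ∈ U} with hU'
  have hU'm : MeasurableSet U' := hUm
  have hU'P : U' ⊆ P := fun w hw => hU hw
  have hPle : X.coordMeasure P ≤ ENNReal.ofReal (c ^ 2 * (sX * sY * h)) := by
    -- In the graph a point has many coordinate triples, so `P` can exceed `E₁ × E₂ × [hbot, htop]`.
    -- The ambiguity stays within the scales of the top and the bottom, at which the base of the box
    -- is wide.
    have hsub : P ⊆ (thick NL htop SX ×ˢ thick NU (-hbot) SY) ×ˢ Icc hbot htop := by
      rintro ⟨⟨x, y⟩, z⟩ ⟨x', hx', y', hy', z', hz', heq⟩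
      obtain ⟨h1, h2, rfl⟩ := H.coord_eq _ _ _ _ _ _ heq
      exact ⟨⟨⟨x', hE₁ hx', H.scaleL.mono hz'.2 (H.scaleL.symm h1)⟩,
        ⟨y', hE₂ hy', H.scaleU.mono (neg_le_neg hz'.1) (H.scaleU.symm h2)⟩⟩, hz'⟩
    refine (measure_mono hsub).trans ?_
    rw [H.coordMeasure_prod, Real.volume_Icc]
    refine (mul_le_mul' (mul_le_mul' hSX.thick_le hSY.thick_le) le_rfl).trans (le_of_eq ?_)
    rw [hsXe, hsYe, ← ENNReal.ofReal_mul hc.le, ← ENNReal.ofReal_mul hc.le,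
      ← ENNReal.ofReal_mul (by positivity), ← ENNReal.ofReal_mul (by positivity)]
    congr 1; ring
  have hPU : X.coordMeasure (P \ U') ≤
      ENNReal.ofReal (128 * √θ) * ENNReal.ofReal (c ^ 2 * (sX * sY * h)) :=
    (measure_diff_le_of_ofReal_mul_le hU'm hU'P (hPle.trans_lt ENNReal.ofReal_lt_top).ne
      hUv).trans (mul_le_mul' le_rfl hPle)
  set D : Set X.Coord := ((E₁ ×ˢ E₂) ×ˢ Icc hbot htop) \ U'
  have hDm : MeasurableSet D := ((hE₁m.prod hE₂m).prod measurableSet_Icc).diff hU'm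
  have hD : X.coordMeasure D ≤ ENNReal.ofReal (128 * √θ * (c ^ 2 * (sX * sY * h))) := by
    rw [ENNReal.ofReal_mul (by positivity)]
    refine (measure_mono ?_).trans hPU
    rintro ⟨⟨x, y⟩, z⟩ ⟨⟨⟨hx, hy⟩, hz⟩, hn⟩
    exact ⟨⟨x, hx, y, hy, z, hz, rfl⟩, hn⟩
  have hm2 : Measurable fun w : X.Lower × X.Upper => volume (Prod.mk w ⁻¹' D) :=
    measurable_measure_prodMk_left hDm
  set k : X.Lower → ENNReal := fun x =>
    ∫⁻ y, volume (Prod.mk (x, y) ⁻¹' D) ∂X.upperMeasure with hk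
  have hkm : Measurable k := hm2.lintegral_prod_right'
  have hkD : ∫⁻ x, k x ∂X.lowerMeasure = X.coordMeasure D := by
    rw [coordMeasure, Measure.prod_apply hDm, lintegral_prod _ hm2.aemeasurable]
  -- The bad volume is proportional to `√θ = τ²`: Markov in `x` uses one factor `τ` and leaves the
  -- other for Markov in `y`.
  set b : ℝ := τ * c ^ 2 * (sY * h) with hb
  have hb0 : 0 < b := by positivity
  refine ⟨{x ∈ E₁ | k x < ENNReal.ofReal b}, fun x hx => hx.1, ?_, ?_⟩
  · have hmark : X.lowerMeasure {x | ENNReal.ofReal b ≤ k x} ≤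
        ENNReal.ofReal (128 * τ) * X.lowerMeasure SX := by
      have h1 := (mul_meas_ge_le_lintegral (μ := X.lowerMeasure) hkm (ENNReal.ofReal b)).trans
        (hkD.le.trans hD)
      rw [← ENNReal.mul_le_mul_iff_right (ENNReal.ofReal_pos.2 hb0).ne' ENNReal.ofReal_ne_top]
      refine h1.trans (le_of_eq ?_)
      rw [hsXe, ← ENNReal.ofReal_mul (by positivity), ← ENNReal.ofReal_mul (by positivity)]
      congr 1
      rw [hτ2, hb]; ring
    refine (measure_mono (t := (SX \ E₁) ∪ {x | ENNReal.ofReal b ≤ k x}) ?_).trans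
      ((measure_union_le _ _).trans ?_)
    · rintro x ⟨hx, hx'⟩
      by_cases hxE : x ∈ E₁
      · exact Or.inr (not_lt.1 fun hlt => hx' ⟨hxE, hlt⟩)
      · exact Or.inl ⟨hx, hxE⟩
    · rw [ENNReal.ofReal_add hθ.le (by positivity), add_mul]
      exact add_le_add hm₁ hmark
  · rintro x ⟨hx, hkx⟩ a d hd ha had F hF
    -- If `y` is not in `F`, the whole vertical segment of length `d` above `(x, y)` is bad.
    have hsub : E₂ \ F ⊆ {y | ENNReal.ofReal d ≤ volume (Prod.mk (x, y) ⁻¹' D)} := by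
      rintro y ⟨hy, hyF⟩
      have : Ioo a (a + d) ⊆ Prod.mk (x, y) ⁻¹' D := fun z hz =>
        ⟨⟨⟨hx, hy⟩, by linarith [hz.1], by linarith [hz.2]⟩, fun hzU => hyF (hF y hy z hz hzU)⟩
      have h2 := measure_mono (μ := volume) this
      rw [Real.volume_Ioo, add_sub_cancel_left] at h2
      exact h2
    refine (measure_mono hsub).trans ?_
    have h1 := (mul_meas_ge_le_lintegral (μ := X.upperMeasure)
      (f := fun y => volume (Prod.mk (x, y) ⁻¹' D)) (hm2.comp measurable_prodMk_left)
      (ENNReal.ofReal d)).trans hkx.le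
    rw [← ENNReal.mul_le_mul_iff_right (ENNReal.ofReal_pos.2 hd).ne' ENNReal.ofReal_ne_top]
    refine h1.trans (le_of_eq ?_)
    rw [hsYe, ← ENNReal.ofReal_mul (by positivity), ← ENNReal.ofReal_mul (by positivity)]
    congr 1
    rw [hb]; field_simp

end ModelSpace

/-! ### The height estimate and the choice of constants -/

namespace ModelSpace

variable {X X' : ModelSpace} {c c' : ℝ} {NL : ℝ → X.Lower → X.Lower → Prop}
  {NU : ℝ → X.Upper → X.Upper → Prop} {NL' : ℝ → X'.Lower → X'.Lower → Prop}
  {NU' : ℝ → X'.Upper → X'.Upper → Prop}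

/-- The error in heights per unit of the size of the box. -/
noncomputable def relativeError (κ K c' ε θ : ℝ) : ℝ := ((3 + 2 * c') * K + 1) * ε + κ * √θ

set_option maxHeartbeats 1000000 in
/-- The height function of a near product map is affine up to a small multiple of the size, and its
constant term is read off from the size of the coarsened image of the upper boundary. -/
theorem IsCoarse.exists_height_estimate (H : X.IsCoarse c NL NU) (H' : X'.IsCoarse c' NL' NU')
    {κ C K β' β'' : ℝ} (hκ : 1 ≤ κ) (hC : 0 ≤ C) (hK : 0 < K) (hβ'' : 0 < β'')
    (hββ : β' ≤ β'' / c) :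
    ∃ δ₀ : ℝ, 0 < δ₀ ∧ ∀ ε θ : ℝ, 0 < ε → ε < δ₀ → 0 < θ → θ < δ₀ →
    ∃ R₀ : ℝ, ∀ R : ℝ, R₀ ≤ R →
    ∀ (SX : Set X.Lower) (SY : Set X.Upper) (hbot htop : ℝ), htop - hbot ≤ R + 1 →
    IsWide X.lowerMeasure NL c htop θ SX → IsWide X.upperMeasure NU c (-hbot) θ SY →
    ∀ (φ : X.Pt → X'.Pt) (E₁ : Set X.Lower) (E₂ : Set X.Upper) (f : X.Lower → X'.Lower)
      (g : X.Upper → X'.Upper) (q : ℝ → ℝ),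
      IsNearProduct X X' κ C (K * ε * R) E₁ E₂ hbot htop φ f g q →
    E₁ ⊆ SX → E₂ ⊆ SY → X.lowerMeasure (SX \ E₁) ≤ ENNReal.ofReal θ * X.lowerMeasure SX →
    X.upperMeasure (SY \ E₂) ≤ ENNReal.ofReal θ * X.upperMeasure SY →
    ∀ F ⊆ E₂, ENNReal.ofReal ((X.upperMeasure SY).toReal / 2) ≤ X.upperMeasure F →
    ∀ z₁ z₂ : ℝ, |z₂ - z₁| ≤ β' * R → hbot + 4 * κ ^ 2 * β'' * R ≤ z₁ →
      z₁ + 4 * κ ^ 2 * β'' * R ≤ htop → hbot + 4 * κ ^ 2 * β'' * R ≤ z₂ →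
      z₂ + 4 * κ ^ 2 * β'' * R ≤ htop →
      0 < X'.upperMeasure (X'.coarsenUpper (q z₁) (g '' F)) ∧
      X'.upperMeasure (X'.coarsenUpper (q z₁) (g '' F)) < ⊤ ∧
      |q z₂ - (X.branching / X'.branching * z₂ - 1 / X'.branching *
        Real.log ((X'.upperMeasure (X'.coarsenUpper (q z₁) (g '' F))).toReal /
          (X.upperMeasure SY).toReal))| ≤
        (4 * X'.branching * relativeError κ K c' ε θ + 2 * ε) / X'.branching * R := by
  have hc := H.pos
  have hc' := H'.pos
  have hB := H.branching_pos
  have hB' := H'.branching_pos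
  have hκ0 : 0 < κ := by linarith
  obtain ⟨MA, hMA, hA⟩ := exists_coordMeasure_le_image H H' hκ hC
  obtain ⟨MB, hMB, hB⟩ := exists_coordMeasure_le_preimage H H' hκ hC
  set M₁ := c ^ 2 * c' * Real.exp (X.branching * c + X'.branching * c') with hM₁
  have hM₁0 : 0 < M₁ := by positivity
  set M₂ := c' ^ 2 * Real.exp (X'.branching * (1 + c')) with hM₂
  have hM₂0 : 0 < M₂ := by positivity
  set K₀ := C + (2 * c' + 1) + c' * (κ * c + 3 * C + (2 * c' + 1) + κ * (2 * c + 1) + 2) with hK₀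
  set K₂ := c * (κ * ((2 * c' + 1) + C + 2 * C) + (2 * c + 1) + 1) with hK₂
  -- In order: half of `E₁` and `E₂` stays interior; the bad volume is at most half of the available
  -- `w / 4`; the slab is thinner than `β''R`; the error `KεR` fits into the margin.
  refine ⟨min (1 / 4) (min ((1 / (32 * MA * MB)) ^ 2) (min (β'' ^ 2) (β'' / (2 * c * κ * K)))),
    by positivity, ?_⟩
  intro ε θ hε hεδ hθ hθδ
  simp only [lt_min_iff] at hεδ hθδ
  obtain ⟨-, -, -, hε1⟩ := hεδ
  obtain ⟨hθ1, hθ2, hθ3, -⟩ := hθδ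
  have hσ0 : 0 < √θ := Real.sqrt_pos.2 hθ
  have hσσ : √θ * √θ = θ := Real.mul_self_sqrt hθ.le
  have hσ2 : √θ ≤ 1 / (32 * MA * MB) := (Real.sqrt_le_left (by positivity)).2 hθ2.le
  have hσ3 : √θ ≤ β'' := (Real.sqrt_le_left hβ''.le).2 hθ3.le
  set σ := √θ with hσ
  set η := relativeError κ K c' ε θ with hη
  have hη0 : 0 < η := by rw [hη, relativeError]; positivity
  -- Large `R` absorbs the additive constants into `εR` or `β''R`, and the logarithms of the
  -- multiplicative constants into `εR`.
  refine ⟨max 1 (max (K₀ / ε) (max (K₂ / β'') (max (Real.log (16 * MA * M₁ ^ 2 * η / σ) / ε)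
    (max (Real.log (8 * (MA * M₁ * M₂) * η / σ) / ε) (Real.log M₁ / ε))))), fun R hR => ?_⟩
  simp only [max_le_iff, div_le_iff₀ hε, div_le_iff₀ hβ''] at hR
  obtain ⟨hR1, hRK₀, hRK₂, hRL₁, hRL₂, hRL₃⟩ := hR
  intro SX SY hbot htop hh hSX hSY φ E₁ E₂ f g q P hE₁ hE₂ hm₁ hm₂ F hF hFm z₁ z₂ hz hz₁ hz₁' hz₂ hz₂'
  have hR0 : 0 < R := by linarith
  -- Thickness `√θ R` is large against the bad part, of order `θR`, yet small against `R`.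
  set w := σ * R with hw
  have hw0 : 0 < w := by positivity
  set e := η * R with he
  have he0 : 0 < e := by positivity
  have hherr : heightError κ C c c' (K * ε * R) w ≤ e := by
    have : e = (3 + 2 * c') * (K * ε * R) + κ * w + R * ε := by
      rw [he, hη, relativeError, hw]; ring
    rw [this, heightError]
    have e2 : 3 * (K * ε * R) + κ * w + C + (2 * c' + 1) + c' * (2 * (K * ε * R) + κ * c + 3 * C +
      (2 * c' + 1) + κ * (2 * c + 1) + 2) = (3 + 2 * c') * (K * ε * R) + κ * w + K₀ := by
      rw [hK₀]; ring
    rw [e2]; linarith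
  have hκβ : 0 ≤ κ ^ 2 * β'' * R := by positivity
  have hκ2 : β'' * R ≤ κ ^ 2 * β'' * R := by
    have : 1 ≤ κ ^ 2 := one_le_pow₀ hκ
    have h3 : 0 ≤ β'' * R := by positivity
    nlinarith
  have hwβ : w ≤ β'' * R := by rw [hw]; gcongr
  -- Four contributions share the `4κ²β''R`: the height difference (using `cβ' ≤ β''`), the error
  -- `KεR`, the constant `K₂`, and the thickness `w`.
  have hmargin : IsNearProduct.margin κ C c c' (K * ε * R) |z₂ - z₁| + w ≤
      4 * κ ^ 2 * β'' * R := by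
    have h1 : IsNearProduct.margin κ C c c' (K * ε * R) |z₂ - z₁| =
        κ ^ 2 * (c * |z₂ - z₁|) + (2 * c * κ * K) * ε * R + K₂ := by
      rw [IsNearProduct.margin, hK₂]; ring
    have h2 : c * |z₂ - z₁| ≤ β'' * R := by
      rw [le_div_iff₀ hc] at hββ
      calc c * |z₂ - z₁| ≤ c * (β' * R) := by gcongr
        _ = β' * c * R := by ring
        _ ≤ _ := by gcongr
    have h3 : κ ^ 2 * (c * |z₂ - z₁|) ≤ κ ^ 2 * (β'' * R) := by gcongr
    have h4 : (2 * c * κ * K) * ε * R ≤ β'' * R := by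
      rw [lt_div_iff₀ (by positivity)] at hε1
      gcongr
      linarith
    rw [h1]
    linarith
  have hmargin0 : 0 ≤ IsNearProduct.margin κ C c c' (K * ε * R) |z₂ - z₁| := by
    rw [IsNearProduct.margin]; positivity
  have hI₁ : z₁ ∈ Icc hbot htop := ⟨by linarith, by linarith⟩
  have hI₂ : z₂ ∈ Icc hbot htop := ⟨by linarith, by linarith⟩
  -- The flow gives one inequality only, but for either order of the two heights; using it both ways
  -- yields the two-sided bound.
  have hslope : ∀ u v, u ∈ Icc hbot htop → v ∈ Icc hbot htop → |v - u| = |z₂ - z₁| →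
      hbot + 4 * κ ^ 2 * β'' * R ≤ u → u + 4 * κ ^ 2 * β'' * R ≤ htop →
      X'.branching * (q v - q u) - X.branching * (v - u) ≤ 2 * X'.branching * e + R * ε := by
    intro u v hu hv huv hu1 hu2
    have key := P.width_le H H' hMA hMB hA hB hθ.le hθ1.le hSX hSY hE₁ hE₂ hm₁ hm₂ (z₁ := u)
      (z₂ := v) hw0.le hv (by rw [huv]; linarith) (by rw [huv]; linarith) hherr
    rw [← hM₁] at key
    have h1 : 2 * MA * MB * θ * (htop - hbot) ≤ w / 8 := by
      rw [le_div_iff₀ (by positivity)] at hσ2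
      calc 2 * MA * MB * θ * (htop - hbot) ≤ 2 * MA * MB * θ * (2 * R) := by gcongr; linarith
        _ = (σ * (32 * MA * MB)) * (σ * R) / 8 := by rw [← hσσ]; ring
        _ ≤ 1 * (σ * R) / 8 := by gcongr
        _ = w / 8 := by rw [hw]; ring
    have h2 : w / 8 ≤ 2 * MA * M₁ ^ 2 * e * Real.exp (X.branching * (v - u) -
        X'.branching * (q v - q u) + 2 * X'.branching * e) := by linarith
    have h3 := neg_le_log_div_of_le_mul_exp (by positivity) h2
    have h4 : 2 * MA * M₁ ^ 2 * e / (w / 8) = 16 * MA * M₁ ^ 2 * η / σ := by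
      rw [he, hw]; field_simp; ring
    rw [h4] at h3
    linarith
  have hs1 := hslope z₁ z₂ hI₁ hI₂ rfl hz₁ hz₁'
  have hs2 := hslope z₂ z₁ hI₂ hI₁ (abs_sub_comm _ _) hz₂ hz₂'
  set s := (X.upperMeasure SY).toReal with hs
  have hs0 : 0 < s := ENNReal.toReal_pos hSY.pos.ne' hSY.lt_top.ne
  have hup := P.measure_coarsenUpper_le H H' hI₁ hw0.le hherr hE₂ hSY hF
  have hfin := hup.trans_lt ENNReal.ofReal_lt_top
  obtain ⟨D₁, hD₁, hD₁m, -⟩ := hSX.exists_interior hm₁ hθ.le hθ1.le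
  have hlow := P.le_measure_coarsenUpper H H' hMA hA hs0.le hSX hE₁
    (hD₁m.trans (measure_mono hD₁)) hF hFm hw0.le hI₁.1 (by linarith) hherr hfin.ne
  have hup' := ENNReal.toReal_mono ENNReal.ofReal_ne_top hup
  rw [ENNReal.toReal_ofReal (by positivity), ← hs, ← hM₁] at hup'
  rw [← hM₁, ← hM₂] at hlow
  set n := (X'.upperMeasure (X'.coarsenUpper (q z₁) (g '' F))).toReal with hn
  have hn0 : 0 < n := by
    refine lt_of_le_of_ne ENNReal.toReal_nonneg fun h0 => ?_
    rw [← h0, mul_zero] at hlow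
    have : 0 < s * w / 4 := by positivity
    linarith
  refine ⟨(ENNReal.toReal_pos_iff.1 hn0).1, hfin, ?_⟩
  have hlog : Real.exp (Real.log (n / s)) = n / s := Real.exp_log (by positivity)
  have hupper : Real.log (n / s) ≤ X.branching * z₁ - X'.branching * q z₁ + X'.branching * e +
      R * ε := by
    have h1 : (1 : ℝ) ≤ M₁ * Real.exp (X'.branching * (-q z₁ + e) + X.branching * z₁ -
        Real.log (n / s)) := by
      rw [Real.exp_sub, hlog, ← mul_div_assoc, le_div_iff₀ (by positivity), one_mul,
        div_le_iff₀ hs0]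
      linarith
    have h2 := neg_le_log_div_of_le_mul_exp one_pos h1
    rw [div_one] at h2
    linarith
  have hlower : X.branching * z₁ - X'.branching * q z₁ - 2 * X'.branching * e - R * ε ≤
      Real.log (n / s) := by
    have h1 : w / 4 ≤ (MA * M₁ * M₂ * (2 * e)) * Real.exp (X'.branching * q z₁ -
        X.branching * z₁ + 2 * X'.branching * e + Real.log (n / s)) := by
      rw [Real.exp_add _ (Real.log (n / s)), hlog, ← mul_assoc, ← mul_div_assoc, le_div_iff₀ hs0]
      linarith
    have h2 := neg_le_log_div_of_le_mul_exp (by positivity) h1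
    have h4 : MA * M₁ * M₂ * (2 * e) / (w / 4) = 8 * (MA * M₁ * M₂) * η / σ := by
      rw [he, hw]; field_simp; ring
    rw [h4] at h2
    linarith
  have hBe : 0 ≤ X'.branching * e := by positivity
  rw [show q z₂ - (X.branching / X'.branching * z₂ - 1 / X'.branching * Real.log (n / s)) =
      (X'.branching * q z₂ - X.branching * z₂ + Real.log (n / s)) / X'.branching by
    field_simp; ring, abs_div, abs_of_pos hB', div_mul_eq_mul_div]
  refine div_le_div_of_nonneg_right ?_ hB'.le
  rw [show (4 * X'.branching * η + 2 * ε) * R = 4 * X'.branching * e + 2 * (R * ε) by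
    rw [he]; ring, abs_le]
  constructor <;> linarith

/-- Given the estimate for any large `F`, it remains to produce such an `F` from the horocycle: one
good point of `π_-(H₀)` suffices, and the estimate is applied with `zbot` as base height. -/
theorem IsCoarse.height_affine (H : X.IsCoarse c NL NU) (H' : X'.IsCoarse c' NL' NU')
    {κ C K : ℝ} (hκ : 1 ≤ κ) (hC : 0 ≤ C) (hK : 0 < K) :
    ∃ b'' : ℝ, 0 < b'' ∧ ∀ β'' : ℝ, 0 < β'' → β'' < b'' →
    ∃ b' : ℝ, 0 < b' ∧ ∀ β' : ℝ, 0 < β' → β' < b' →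
    ∃ b : ℝ, 0 < b ∧ ∀ β : ℝ, 0 < β → β < b →
    ∃ (δ₀ : ℝ) (ε' c : ℝ → ℝ → ℝ), 0 < δ₀ ∧
      Tendsto (fun p : ℝ × ℝ => ε' p.1 p.2) (𝓝[>] 0 ×ˢ 𝓝[>] 0) (𝓝 0) ∧
      Tendsto (fun p : ℝ × ℝ => c p.1 p.2) (𝓝[>] 0 ×ˢ 𝓝[>] 0) (𝓝 0) ∧
    ∀ ε θ : ℝ, 0 < ε → ε < δ₀ → 0 < θ → θ < δ₀ →
    ∀ ρ₁ : ℝ, 0 < ρ₁ →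
    ∃ R₀ : ℝ, 0 < R₀ ∧ ∀ R : ℝ, R₀ ≤ R →
    ∀ (SX : Set X.Lower) (SY : Set X.Upper) (hbot htop : ℝ), X.IsBox R SX SY hbot htop →
    ∀ φ : X.Pt → X'.Pt, X.IsQuasiIsometry X' κ C φ →
    ∀ (E₁ : Set X.Lower) (E₂ : Set X.Upper) (f : X.Lower → X'.Lower) (g : X.Upper → X'.Upper)
      (q : ℝ → ℝ), X.IsAlmostProduct X' R (K * ε) θ SX SY hbot htop φ E₁ E₂ f g q →
    ∀ U' : Set X.Pt, U' ⊆ X.productSet E₁ E₂ hbot htop → X.IsMeasurable U' →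
      ENNReal.ofReal (1 - 128 * Real.sqrt θ) * X.vol (X.productSet E₁ E₂ hbot htop) ≤ X.vol U' →
    ∃ E' : Set X.Lower, E' ⊆ SX ∧ E'.Nonempty ∧
      X.lowerMeasure (SX \ E') ≤ ENNReal.ofReal (c ε θ) * X.lowerMeasure SX ∧
    ∀ x₀ ∈ SX, ∀ h₀ : ℝ, 4 * κ ^ 2 * β'' * R < htop - h₀ → 4 * κ ^ 2 * β'' * R < h₀ - hbot →
      (X.piMinus ρ₁ (X.yHorocycle x₀ h₀) ∩ E').Nonempty →
    ∀ a : ℝ, a = h₀ - β'' * R ∨ a = h₀ →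
    ∀ S : Set X.Pt,
      S = X.slab (X.piMinus ρ₁ (X.yHorocycle x₀ h₀)) SY a (a + β'' * R) ∩ U' →
    ∀ zbot ztop : ℝ, hbot < zbot → zbot < ztop → ztop < htop →
      4 * β * R ≤ |ztop - zbot| → |ztop - zbot| ≤ β' * R →
      4 * κ ^ 2 * β'' * R < |htop - ztop| → 4 * κ ^ 2 * β'' * R < |zbot - hbot| →
      0 < X'.upperMeasure (X'.coarsenUpper (q zbot) (g '' (X.yCoords SY S ∩ E₂))) ∧
      X'.upperMeasure (X'.coarsenUpper (q zbot) (g '' (X.yCoords SY S ∩ E₂))) < ⊤ ∧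
      ∀ z ∈ Icc zbot ztop,
        |q z - (X.branching / X'.branching * z - 1 / X'.branching *
          Real.log ((X'.upperMeasure (X'.coarsenUpper (q zbot)
            (g '' (X.yCoords SY S ∩ E₂)))).toReal / (X.upperMeasure SY).toReal))|
          ≤ ε' ε θ * R := by
  have hc := H.pos
  have hB' := H'.branching_pos
  refine ⟨1, one_pos, fun β'' hβ'' _ => ⟨β'' / c, by positivity, fun β' hβ' hββ =>
    ⟨1, one_pos, fun β _ _ => ?_⟩⟩⟩
  obtain ⟨δ₁, hδ₁, hest⟩ := H.exists_height_estimate H' hκ hC hK hβ'' hββ.le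
  -- For `τ = √√θ ≤ τ₀`: `128τ ≤ 1/4` makes the exceptional set in `SX` proper, and `8c²τ ≤ β''`
  -- makes the part of `E₂` missed by `F` at most a quarter of `SY`.
  set τ₀ := min (1 / 512) (β'' / (8 * c ^ 2)) with hτ₀
  have hτ₀0 : 0 < τ₀ := by positivity
  have hfst : Tendsto (fun p : ℝ × ℝ => p.1) (𝓝[>] 0 ×ˢ 𝓝[>] 0) (𝓝 0) :=
    (tendsto_nhdsWithin_iff.1 tendsto_fst).1
  have hsnd : Tendsto (fun p : ℝ × ℝ => p.2) (𝓝[>] 0 ×ˢ 𝓝[>] 0) (𝓝 0) :=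
    (tendsto_nhdsWithin_iff.1 tendsto_snd).1
  have hsqrt : Tendsto (fun p : ℝ × ℝ => √p.2) (𝓝[>] 0 ×ˢ 𝓝[>] 0) (𝓝 0) := by
    simpa using hsnd.sqrt
  refine ⟨min δ₁ (min (1 / 4) (τ₀ ^ 4)),
    fun ε θ => (4 * X'.branching * relativeError κ K c' ε θ + 2 * ε) / X'.branching,
    fun _ θ => θ + 128 * √√θ, by positivity, ?_, ?_, ?_⟩
  · have h1 : Tendsto (fun p : ℝ × ℝ => relativeError κ K c' p.1 p.2) (𝓝[>] 0 ×ˢ 𝓝[>] 0)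
        (𝓝 (((3 + 2 * c') * K + 1) * 0 + κ * 0)) :=
      (hfst.const_mul _).add (hsqrt.const_mul _)
    have h2 := ((h1.const_mul (4 * X'.branching)).add (hfst.const_mul 2)).div_const X'.branching
    simpa using h2
  · have h1 := hsqrt.sqrt
    have h2 := hsnd.add ((by simpa using h1 : Tendsto (fun p : ℝ × ℝ => √√p.2)
      (𝓝[>] 0 ×ˢ 𝓝[>] 0) (𝓝 0)).const_mul 128)
    simpa using h2
  intro ε θ hε hεδ hθ hθδ ρ₁ _
  simp only [lt_min_iff] at hεδ hθδ
  obtain ⟨hεδ, -, -⟩ := hεδ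
  obtain ⟨hθδ, hθ4, hθτ⟩ := hθδ
  have hτ : √√θ ≤ τ₀ := by
    rw [Real.sqrt_le_left hτ₀0.le, Real.sqrt_le_left (by positivity), ← pow_mul]
    exact hθτ.le
  have hτ1 : √√θ ≤ 1 / 512 := hτ.trans (min_le_left _ _)
  have hτ2 : √√θ ≤ β'' / (8 * c ^ 2) := hτ.trans (min_le_right _ _)
  obtain ⟨R₁, hR₁⟩ := hest ε θ hε hεδ hθ hθδ
  obtain ⟨R₂, hR₂⟩ := H.box θ hθ
  refine ⟨max 1 (max R₁ R₂), by positivity, ?_⟩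
  intro R hR SX SY hbot htop hbox φ hφ E₁ E₂ f g q hprod U' hU' hU'm hU'v
  simp only [max_le_iff] at hR
  obtain ⟨hR1, hRR₁, hRR₂⟩ := hR
  have hR0 : 0 < R := by linarith
  obtain ⟨hh1, hh2, hSX, hSY⟩ := hR₂ R hRR₂ SX SY hbot htop hbox
  have hm₁ := measure_diff_le_of_ofReal_mul_le hprod.measurable_lower hprod.subset_lower
    hSX.lt_top.ne hprod.measure_lower
  have hm₂ := measure_diff_le_of_ofReal_mul_le hprod.measurable_upper hprod.subset_upper
    hSY.lt_top.ne hprod.measure_upper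
  obtain ⟨E', hE'E₁, hE'm, hE'⟩ := H.exists_good_lower hSX hSY hprod.subset_lower
    hprod.subset_upper hprod.measurable_lower hprod.measurable_upper hθ (by linarith) hU' hU'm
    hU'v hm₁
  have hlt : ∀ {α : Type} [MeasurableSpace α] (μ : Measure α) (S T : Set α) (t : ℝ), 0 < μ S →
      μ S < ⊤ → t < 1 → μ (S \ T) ≤ ENNReal.ofReal t * μ S → T.Nonempty := by
    intro α _ μ S T t hS hS' ht h
    rw [nonempty_iff_ne_empty]
    rintro rfl
    rw [sdiff_empty] at h
    have h1 : ENNReal.ofReal t * μ S < 1 * μ S :=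
      ENNReal.mul_lt_mul_left hS.ne' hS'.ne (by
        rw [← ENNReal.ofReal_one]; exact (ENNReal.ofReal_lt_ofReal_iff one_pos).2 ht)
    rw [one_mul] at h1
    exact absurd h (not_le.2 h1)
  have hP : IsNearProduct X X' κ C (K * ε * R) E₁ E₂ hbot htop φ f g q :=
    { one_le := hκ
      C_nonneg := hC
      delta_nonneg := by positivity
      quasi := hφ
      nonempty_lower := hlt _ _ _ _ hSX.pos hSX.lt_top (by linarith) hm₁
      nonempty_upper := hlt _ _ _ _ hSY.pos hSY.lt_top (by linarith) hm₂
      close := hprod.close }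
  refine ⟨E', hE'E₁.trans hprod.subset_lower,
    hlt _ _ _ _ hSX.pos hSX.lt_top (by linarith) hE'm, hE'm, ?_⟩
  rintro x₀ - h₀ hh₀ hh₀' ⟨x, hxH, hxE'⟩ a ha S rfl zbot ztop hzb hzz hzt - hz₁ hzt' hzb'
  have hκ2 : β'' * R ≤ 4 * κ ^ 2 * β'' * R := by
    have : 1 ≤ κ ^ 2 := one_le_pow₀ hκ
    have h3 : 0 < β'' * R := by positivity
    nlinarith
  have hβR : 0 < β'' * R := by positivity
  set F := X.yCoords SY (X.slab (X.piMinus ρ₁ (X.yHorocycle x₀ h₀)) SY a (a + β'' * R) ∩ U') ∩ E₂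
    with hF
  have hFE : F ⊆ E₂ := inter_subset_right
  -- As `x` itself lies in `π_-(H₀)`, every point of `U'` above it in the layer puts its upper
  -- coordinate into `F`.
  have hEF := hE' x hxE' a (β'' * R) hβR (by rcases ha with rfl | rfl <;> linarith)
    (by rcases ha with rfl | rfl <;> linarith) F (fun y hy z hz hzU =>
      ⟨⟨hprod.subset_upper hy, x, z, ⟨x, hxH, y, hprod.subset_upper hy, z, hz.1, hz.2, rfl⟩, hzU⟩,
        hy⟩)
  have hFm : ENNReal.ofReal ((X.upperMeasure SY).toReal / 2) ≤ X.upperMeasure F := by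
    have h1 : √√θ * c ^ 2 * ((htop - hbot) / (β'' * R)) ≤ 1 / 4 := by
      rw [le_div_iff₀ (by positivity)] at hτ2
      calc √√θ * c ^ 2 * ((htop - hbot) / (β'' * R)) ≤ √√θ * c ^ 2 * ((2 * R) / (β'' * R)) := by
            gcongr; linarith
        _ = (√√θ * (8 * c ^ 2)) / β'' / 4 := by field_simp; ring
        _ ≤ β'' / β'' / 4 := by gcongr
        _ = 1 / 4 := by rw [div_self hβ''.ne']
    have h2 : X.upperMeasure SY ≤ X.upperMeasure F + ENNReal.ofReal (1 / 4) * X.upperMeasure SY +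
        ENNReal.ofReal (1 / 4) * X.upperMeasure SY := by
      refine (measure_mono (t := F ∪ (E₂ \ F) ∪ (SY \ E₂)) fun y hy => ?_).trans
        ((measure_union_le _ _).trans (add_le_add ((measure_union_le _ _).trans (add_le_add le_rfl
          (hEF.trans (by gcongr)))) (hm₂.trans (by gcongr))))
      by_cases h : y ∈ F <;> by_cases h' : y ∈ E₂ <;> simp [hy, h, h']
    have hfin : X.upperMeasure F ≠ ⊤ :=
      measure_ne_top_of_subset (hFE.trans hprod.subset_upper) hSY.lt_top.ne
    have hSYf := hSY.lt_top.ne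
    rw [ENNReal.ofReal_le_iff_le_toReal hfin]
    have h3 := ENNReal.toReal_mono (by finiteness) h2
    rw [ENNReal.toReal_add (by finiteness) (by finiteness),
      ENNReal.toReal_add (by finiteness) (by finiteness), ENNReal.toReal_mul,
      ENNReal.toReal_ofReal (by norm_num)] at h3
    linarith
  rw [abs_of_pos (by linarith)] at hz₁ hzt' hzb'
  have hmain : ∀ z ∈ Icc zbot ztop, _ := fun z hz =>
    hR₁ R hRR₁ SX SY hbot htop hh2 hSX hSY φ E₁ E₂ f g q hP hprod.subset_lower hprod.subset_upper
      hm₁ hm₂ F hFE hFm zbot z (by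
        rw [abs_of_nonneg (by linarith [hz.1])]
        linarith [hz.2]) (by linarith) (by linarith) (by linarith [hz.1]) (by linarith [hz.2])
  have h0 := hmain zbot ⟨le_rfl, hzz.le⟩
  exact ⟨h0.1, h0.2.1, fun z hz => (hmain z hz).2.2⟩

end ModelSpace

/-! ### The metric of Sol(n) -/

/-- The speed in `Sol(n)` of a curve given by its coordinates. -/
noncomputable def solSpeed (n : ℝ) (x y z : ℝ → ℝ) (t : ℝ) : ℝ :=
  Real.sqrt ((deriv z t) ^ 2 + Real.exp (-(2 * n * z t)) * (deriv x t) ^ 2 +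
    Real.exp (2 * n * z t) * (deriv y t) ^ 2)

theorem continuous_solSpeed (n : ℝ) {x y z : ℝ → ℝ} (hx : ContDiff ℝ 1 x) (hy : ContDiff ℝ 1 y)
    (hz : ContDiff ℝ 1 z) : Continuous (solSpeed n x y z) := by
  have h1 := hx.continuous_deriv_one
  have h2 := hy.continuous_deriv_one
  have h3 := hz.continuous_deriv_one
  have h4 := hz.continuous
  unfold solSpeed
  fun_prop

theorem solSpeed_nonneg (n : ℝ) (x y z : ℝ → ℝ) (t : ℝ) : 0 ≤ solSpeed n x y z t :=
  Real.sqrt_nonneg _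

/-- The lengths of the `C¹` curves in `Sol(n)` joining two points. -/
def solLengths (n : ℝ) (p q : ℝ × ℝ × ℝ) : Set ℝ :=
  {l : ℝ | ∃ x y z : ℝ → ℝ, ContDiff ℝ 1 x ∧ ContDiff ℝ 1 y ∧ ContDiff ℝ 1 z ∧
    (x 0, y 0, z 0) = p ∧ (x 1, y 1, z 1) = q ∧ l = ∫ t in (0 : ℝ)..1, solSpeed n x y z t}

theorem solDist_eq_sInf (n : ℝ) (p q : ℝ × ℝ × ℝ) : solDist n p q = sInf (solLengths n p q) := rfl

theorem nonneg_of_mem_solLengths {n : ℝ} {p q : ℝ × ℝ × ℝ} {l : ℝ} (h : l ∈ solLengths n p q) :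
    0 ≤ l := by
  obtain ⟨x, y, z, -, -, -, -, -, rfl⟩ := h
  exact intervalIntegral.integral_nonneg zero_le_one fun t _ => solSpeed_nonneg n x y z t

theorem bddBelow_solLengths (n : ℝ) (p q : ℝ × ℝ × ℝ) : BddBelow (solLengths n p q) :=
  ⟨0, fun _ => nonneg_of_mem_solLengths⟩

theorem solDist_le {n : ℝ} {p q : ℝ × ℝ × ℝ} {l : ℝ} (h : l ∈ solLengths n p q) :
    solDist n p q ≤ l :=
  csInf_le (bddBelow_solLengths n p q) h

theorem deriv_segment (a b t : ℝ) : deriv (fun s : ℝ => a + s * (b - a)) t = b - a := by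
  have := (((hasDerivAt_id t).mul_const (b - a)).const_add a).deriv
  rwa [one_mul] at this

theorem segment_mem_solLengths (n : ℝ) (x x' y y' z z' : ℝ) :
    (∫ t in (0 : ℝ)..1, solSpeed n (fun s => x + s * (x' - x)) (fun s => y + s * (y' - y))
      (fun s => z + s * (z' - z)) t) ∈ solLengths n (x, y, z) (x', y', z') :=
  ⟨_, _, _, by fun_prop, by fun_prop, by fun_prop, by simp, by simp, rfl⟩

theorem solLengths_nonempty (n : ℝ) (p q : ℝ × ℝ × ℝ) : (solLengths n p q).Nonempty :=
  ⟨_, segment_mem_solLengths n p.1 q.1 p.2.1 q.2.1 p.2.2 q.2.2⟩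

theorem solDist_vert (n x y z z' : ℝ) : solDist n (x, y, z) (x, y, z') ≤ |z - z'| := by
  refine (solDist_le (segment_mem_solLengths n x x y y z z')).trans (le_of_eq ?_)
  simp only [solSpeed, deriv_segment]
  simp [Real.sqrt_sq_eq_abs, abs_sub_comm]

theorem solDist_lower (n x x' y z : ℝ) :
    solDist n (x, y, z) (x', y, z) ≤ Real.exp (-(n * z)) * |x - x'| := by
  refine (solDist_le (segment_mem_solLengths n x x' y y z z)).trans (le_of_eq ?_)
  simp only [solSpeed, deriv_segment]
  have : Real.exp (-(2 * n * z)) * (x' - x) ^ 2 = (Real.exp (-(n * z)) * (x' - x)) ^ 2 := by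
    rw [mul_pow, ← Real.exp_nat_mul]; congr 2; push_cast; ring
  simp [this, Real.sqrt_sq_eq_abs, abs_mul, abs_sub_comm]

theorem solDist_upper (n x y y' z : ℝ) :
    solDist n (x, y, z) (x, y', z) ≤ Real.exp (n * z) * |y - y'| := by
  refine (solDist_le (segment_mem_solLengths n x x y y' z z)).trans (le_of_eq ?_)
  simp only [solSpeed, deriv_segment]
  have : Real.exp (2 * n * z) * (y' - y) ^ 2 = (Real.exp (n * z) * (y' - y)) ^ 2 := by
    rw [mul_pow, ← Real.exp_nat_mul]; congr 2; push_cast; ring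
  simp [this, Real.sqrt_sq_eq_abs, abs_mul, abs_sub_comm]

theorem mem_solLengths_symm {n : ℝ} {p q : ℝ × ℝ × ℝ} {l : ℝ} (h : l ∈ solLengths n p q) :
    l ∈ solLengths n q p := by
  obtain ⟨x, y, z, hx, hy, hz, rfl, rfl, rfl⟩ := h
  refine ⟨fun t => x (1 - t), fun t => y (1 - t), fun t => z (1 - t), by fun_prop, by fun_prop,
    by fun_prop, by simp, by simp, ?_⟩
  have : ∀ t, solSpeed n (fun t => x (1 - t)) (fun t => y (1 - t)) (fun t => z (1 - t)) t =
      solSpeed n x y z (1 - t) := fun t => by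
    simp [solSpeed, deriv_comp_const_sub]
  simp only [this]
  rw [intervalIntegral.integral_comp_sub_left]
  simp

theorem solDist_comm (n : ℝ) (p q : ℝ × ℝ × ℝ) : solDist n p q = solDist n q p := by
  rw [solDist_eq_sInf, solDist_eq_sInf]
  congr 1
  ext l
  exact ⟨mem_solLengths_symm, mem_solLengths_symm⟩

theorem solSpeed_of_deriv_eq (n : ℝ) {x y z x₁ y₁ z₁ : ℝ → ℝ} {s t a : ℝ} (ha : 0 ≤ a)
    (hzv : z t = z₁ s) (hx : deriv x t = deriv x₁ s * a) (hy : deriv y t = deriv y₁ s * a)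
    (hz : deriv z t = deriv z₁ s * a) : solSpeed n x y z t = solSpeed n x₁ y₁ z₁ s * a := by
  rw [solSpeed, solSpeed, hzv, hx, hy, hz]
  rw [← Real.sqrt_sq ha, ← Real.sqrt_mul' _ (sq_nonneg a), Real.sqrt_sq ha]
  congr 1; ring

/-- To concatenate within `C¹` curves, the first curve is run by `a` on `[0, 1/2]` and the second by
`b` on `[1/2, 1]`, both stopping smoothly at `1/2`. The sum of the two minus the common point avoids
a piecewise definition, and change of variables gives the lengths. -/
theorem add_mem_solLengths {n : ℝ} {p q r : ℝ × ℝ × ℝ} {l l' : ℝ} (h : l ∈ solLengths n p q)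
    (h' : l' ∈ solLengths n q r) : l + l' ∈ solLengths n p r := by
  obtain ⟨x₁, y₁, z₁, hx₁, hy₁, hz₁, rfl, rfl, rfl⟩ := h
  obtain ⟨x₂, y₂, z₂, hx₂, hy₂, hz₂, heq, rfl, rfl⟩ := h'
  simp only [Prod.mk.injEq] at heq
  obtain ⟨hx, hy, hz⟩ := heq
  set a : ℝ → ℝ := fun t => Real.smoothTransition (2 * t) with ha
  set b : ℝ → ℝ := fun t => Real.smoothTransition (2 * t - 1) with hb
  have had : ContDiff ℝ 1 a := Real.smoothTransition.contDiff.comp (by fun_prop)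
  have hbd : ContDiff ℝ 1 b := Real.smoothTransition.contDiff.comp (by fun_prop)
  have ham : Monotone a := fun s t h => Real.smoothTransition.monotone (by linarith)
  have hbm : Monotone b := fun s t h => Real.smoothTransition.monotone (by linarith)
  have ha1 : ∀ t, 1 / 2 ≤ t → a t = 1 := fun t ht =>
    Real.smoothTransition.one_of_one_le (by linarith)
  have hb0 : ∀ t, t ≤ 1 / 2 → b t = 0 := fun t ht =>
    Real.smoothTransition.zero_of_nonpos (by linarith)
  have ha0 : a 0 = 0 := by simp [ha]
  have hb1 : b 1 = 1 := Real.smoothTransition.one_of_one_le (by norm_num)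
  -- Such a `t` is a global maximum of `a`, which also covers the junction `t = 1/2`.
  have hda : ∀ t, 1 / 2 ≤ t → deriv a t = 0 := fun t ht =>
    IsLocalMax.deriv_eq_zero (Eventually.of_forall fun s => by
      rw [ha1 t ht]; exact Real.smoothTransition.le_one _)
  have hdb : ∀ t, t ≤ 1 / 2 → deriv b t = 0 := fun t ht =>
    IsLocalMin.deriv_eq_zero (Eventually.of_forall fun s => by
      rw [hb0 t ht]; exact Real.smoothTransition.nonneg _)
  have hA : ∀ t, HasDerivAt a (deriv a t) t := fun t =>
    (had.differentiable one_ne_zero t).hasDerivAt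
  have hBd : ∀ t, HasDerivAt b (deriv b t) t := fun t =>
    (hbd.differentiable one_ne_zero t).hasDerivAt
  have hder : ∀ u v : ℝ → ℝ, ContDiff ℝ 1 u → ContDiff ℝ 1 v → ∀ t,
      deriv (fun t => u (a t) + v (b t) - u 1) t =
        deriv u (a t) * deriv a t + deriv v (b t) * deriv b t := fun u v hu hv t => by
    have h1 : HasDerivAt (fun t => u (a t)) (deriv u (a t) * deriv a t) t :=
      ((hu.differentiable one_ne_zero _).hasDerivAt).comp t (hA t)
    have h2 : HasDerivAt (fun t => v (b t)) (deriv v (b t) * deriv b t) t :=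
      ((hv.differentiable one_ne_zero _).hasDerivAt).comp t (hBd t)
    exact ((h1.add h2).sub_const _).deriv
  have hcd : ∀ u v : ℝ → ℝ, ContDiff ℝ 1 u → ContDiff ℝ 1 v →
      ContDiff ℝ 1 (fun t => u (a t) + v (b t) - u 1) := fun u v hu hv =>
    ((hu.comp had).add (hv.comp hbd)).sub contDiff_const
  have hhalf : a (1 / 2) = 1 := ha1 _ le_rfl
  have hhalf' : b (1 / 2) = 0 := hb0 _ le_rfl
  refine ⟨fun t => x₁ (a t) + x₂ (b t) - x₁ 1, fun t => y₁ (a t) + y₂ (b t) - y₁ 1,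
    fun t => z₁ (a t) + z₂ (b t) - z₁ 1, hcd _ _ hx₁ hx₂, hcd _ _ hy₁ hy₂, hcd _ _ hz₁ hz₂,
    ?_, ?_, ?_⟩
  · simp [ha0, hb0 0 (by norm_num), hx, hy, hz]
  · simp [hb1, ha1 1 (by norm_num)]
  have hcont := continuous_solSpeed n (hcd _ _ hx₁ hx₂) (hcd _ _ hy₁ hy₂) (hcd _ _ hz₁ hz₂)
  rw [← intervalIntegral.integral_add_adjacent_intervals (b := 1 / 2)
    (hcont.intervalIntegrable _ _) (hcont.intervalIntegrable _ _)]
  congr 1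
  · have h1 : ∫ t in (0 : ℝ)..1 / 2, solSpeed n (fun t => x₁ (a t) + x₂ (b t) - x₁ 1)
        (fun t => y₁ (a t) + y₂ (b t) - y₁ 1) (fun t => z₁ (a t) + z₂ (b t) - z₁ 1) t =
        ∫ t in (0 : ℝ)..1 / 2, (solSpeed n x₁ y₁ z₁ ∘ a) t * deriv a t := by
      refine intervalIntegral.integral_congr fun t ht => ?_
      rw [uIcc_of_le (by norm_num)] at ht
      refine solSpeed_of_deriv_eq n ham.deriv_nonneg (by simp [hb0 t ht.2, hz]) ?_ ?_ ?_ <;>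
      · rw [hder _ _ (by assumption) (by assumption), hdb t ht.2]; ring
    rw [h1, intervalIntegral.integral_comp_mul_deriv (fun t _ => hA t)
      had.continuous_deriv_one.continuousOn (continuous_solSpeed n hx₁ hy₁ hz₁), ha0, hhalf]
  · have h1 : ∫ t in (1 / 2 : ℝ)..1, solSpeed n (fun t => x₁ (a t) + x₂ (b t) - x₁ 1)
        (fun t => y₁ (a t) + y₂ (b t) - y₁ 1) (fun t => z₁ (a t) + z₂ (b t) - z₁ 1) t =
        ∫ t in (1 / 2 : ℝ)..1, (solSpeed n x₂ y₂ z₂ ∘ b) t * deriv b t := by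
      refine intervalIntegral.integral_congr fun t ht => ?_
      rw [uIcc_of_le (by norm_num)] at ht
      refine solSpeed_of_deriv_eq n hbm.deriv_nonneg (by simp [ha1 t ht.1]) ?_ ?_ ?_ <;>
      · rw [hder _ _ (by assumption) (by assumption), hda t ht.1]; ring
    rw [h1, intervalIntegral.integral_comp_mul_deriv (fun t _ => hBd t)
      hbd.continuous_deriv_one.continuousOn (continuous_solSpeed n hx₂ hy₂ hz₂), hb1, hhalf']

theorem solDist_triangle (n : ℝ) (p q r : ℝ × ℝ × ℝ) :
    solDist n p r ≤ solDist n p q + solDist n q r := by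
  refine le_of_forall_pos_le_add fun ε hε => ?_
  obtain ⟨l, hl, hl'⟩ := exists_lt_of_csInf_lt (solLengths_nonempty n p q)
    (show sInf (solLengths n p q) < solDist n p q + ε / 2 by rw [← solDist_eq_sInf]; linarith)
  obtain ⟨m, hm, hm'⟩ := exists_lt_of_csInf_lt (solLengths_nonempty n q r)
    (show sInf (solLengths n q r) < solDist n q r + ε / 2 by rw [← solDist_eq_sInf]; linarith)
  linarith [solDist_le (add_mem_solLengths hl hm)]

/-- The coordinates of the end point of a curve of given length in `Sol(n)`. -/
theorem coord_bounds_of_mem_solLengths {n : ℝ} (hn : 0 < n) {x y z x' y' z' l : ℝ}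
    (h : l ∈ solLengths n (x, y, z) (x', y', z')) : |z - z'| ≤ l ∧
      |x - x'| ≤ Real.exp (n * (z + l)) * l ∧ |y - y'| ≤ Real.exp (n * (-z + l)) * l := by
  obtain ⟨u, v, w, hu, hv, hw, hp, hq, hl⟩ := h
  simp only [Prod.mk.injEq] at hp hq
  obtain ⟨rfl, rfl, rfl⟩ := hp
  obtain ⟨rfl, rfl, rfl⟩ := hq
  have hcont := continuous_solSpeed n hu hv hw
  have hint : ∀ s : ℝ, ∀ k : ℝ → ℝ, ContDiff ℝ 1 k → ∀ M : ℝ, 0 ≤ s →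
      (∀ t ∈ Icc 0 s, |deriv k t| ≤ M * solSpeed n u v w t) →
      |k 0 - k s| ≤ M * ∫ t in (0 : ℝ)..s, solSpeed n u v w t := by
    intro s k hk M hs hM
    rw [abs_sub_comm, ← intervalIntegral.integral_deriv_eq_sub
      (fun t _ => hk.differentiable one_ne_zero t)
      (hk.continuous_deriv_one.intervalIntegrable _ _), ← intervalIntegral.integral_const_mul]
    refine (intervalIntegral.abs_integral_le_integral_abs hs).trans ?_
    exact intervalIntegral.integral_mono_on hs (hk.continuous_deriv_one.abs.intervalIntegrable _ _)
      ((hcont.const_mul M).intervalIntegrable _ _) hM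
  have hle : ∀ s ∈ Icc (0 : ℝ) 1, ∫ t in (0 : ℝ)..s, solSpeed n u v w t ≤ l := by
    intro s hs
    rw [hl, ← intervalIntegral.integral_add_adjacent_intervals
      (hcont.intervalIntegrable 0 s) (hcont.intervalIntegrable s 1)]
    linarith [intervalIntegral.integral_nonneg (μ := volume) hs.2
      fun t _ => solSpeed_nonneg n u v w t]
  have hz : ∀ t, |deriv w t| ≤ 1 * solSpeed n u v w t := fun t => by
    rw [one_mul]
    refine Real.abs_le_sqrt ?_
    have h1 : 0 ≤ Real.exp (-(2 * n * w t)) * deriv u t ^ 2 := by positivity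
    have h2 : 0 ≤ Real.exp (2 * n * w t) * deriv v t ^ 2 := by positivity
    linarith
  -- The height stays within `l` of its initial value along the whole curve, which bounds the factor
  -- converting speed into coordinate velocity.
  have hw' : ∀ s ∈ Icc (0 : ℝ) 1, |w 0 - w s| ≤ l := fun s hs => by
    have := hint s w hw 1 hs.1 fun t _ => hz t
    rw [one_mul] at this
    exact this.trans (hle s hs)
  have h1mem : (1 : ℝ) ∈ Icc (0 : ℝ) 1 := ⟨zero_le_one, le_rfl⟩
  refine ⟨hw' 1 h1mem, ?_, ?_⟩
  · nth_rewrite 2 [hl]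
    refine hint 1 u hu _ zero_le_one fun t ht => ?_
    have h1 : Real.exp (-(n * w t)) * |deriv u t| ≤ solSpeed n u v w t := by
      rw [← abs_of_pos (Real.exp_pos (-(n * w t))), ← abs_mul]
      refine Real.abs_le_sqrt ?_
      have h2 : (Real.exp (-(n * w t)) * deriv u t) ^ 2 =
          Real.exp (-(2 * n * w t)) * deriv u t ^ 2 := by
        rw [mul_pow, ← Real.exp_nat_mul]; congr 2; push_cast; ring
      rw [h2]
      have : 0 ≤ Real.exp (2 * n * w t) * deriv v t ^ 2 := by positivity
      nlinarith [sq_nonneg (deriv w t)]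
    calc |deriv u t| = Real.exp (n * w t) * (Real.exp (-(n * w t)) * |deriv u t|) := by
          rw [← mul_assoc, ← Real.exp_add]; simp
      _ ≤ Real.exp (n * (w 0 + l)) * solSpeed n u v w t := by
          have := abs_le.1 (hw' t ht)
          gcongr
          linarith
  · nth_rewrite 2 [hl]
    refine hint 1 v hv _ zero_le_one fun t ht => ?_
    have h1 : Real.exp (n * w t) * |deriv v t| ≤ solSpeed n u v w t := by
      rw [← abs_of_pos (Real.exp_pos (n * w t)), ← abs_mul]
      refine Real.abs_le_sqrt ?_
      have h2 : (Real.exp (n * w t) * deriv v t) ^ 2 =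
          Real.exp (2 * n * w t) * deriv v t ^ 2 := by
        rw [mul_pow, ← Real.exp_nat_mul]; congr 2; push_cast; ring
      rw [h2]
      have : 0 ≤ Real.exp (-(2 * n * w t)) * deriv u t ^ 2 := by positivity
      nlinarith [sq_nonneg (deriv w t)]
    calc |deriv v t| = Real.exp (-(n * w t)) * (Real.exp (n * w t) * |deriv v t|) := by
          rw [← mul_assoc, ← Real.exp_add]; simp
      _ ≤ Real.exp (n * (-w 0 + l)) * solSpeed n u v w t := by
          have := abs_le.1 (hw' t ht)
          gcongr
          nlinarith

/-! ### The axioms for Sol(n) -/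

/-- Closeness at scale `exp t` on the boundary of `Sol(n)`. -/
def solNear (n t a b : ℝ) : Prop := |a - b| ≤ Real.exp (n * t)

theorem setOf_solNear (n t a : ℝ) :
    {b | solNear n t a b} = Icc (a - Real.exp (n * t)) (a + Real.exp (n * t)) := by
  ext b
  simp only [solNear, mem_ofPred_eq, mem_Icc, abs_le]
  constructor <;> rintro ⟨h1, h2⟩ <;> constructor <;> linarith

theorem solNear_mono {n s t a b : ℝ} (hn : 0 < n) (h : s ≤ t) (hab : solNear n s a b) :
    solNear n t a b :=
  le_trans hab (Real.exp_le_exp.2 (by gcongr))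

/-- With `c = 3 + 1/n` one has `nc = 3n + 1`, hence `e^{nc} ≥ 2` whatever the size of `n`, which is
what adding two distances requires. -/
theorem isScale_solNear {n : ℝ} (hn : 0 < n) :
    IsScale (volume : Measure ℝ) n (3 + 1 / n) (solNear n) where
  one_le := by have : 0 < 1 / n := by positivity
               linarith
  refl t a := by simp [solNear, Real.exp_nonneg]
  symm h := by rw [solNear, abs_sub_comm]; exact h
  mono h hab := solNear_mono hn h hab
  trans {t a b d} h h' := by
    have h2 : (2 : ℝ) * Real.exp (n * t) ≤ Real.exp (n * (t + (3 + 1 / n))) := by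
      have e1 : n * (t + (3 + 1 / n)) = (3 * n + 1) + n * t := by field_simp; ring
      rw [e1, Real.exp_add]
      gcongr
      linarith [Real.add_one_le_exp (3 * n + 1)]
    have h3 := abs_sub_le a b d
    simp only [solNear] at h h' ⊢
    linarith
  measurable t a := by rw [setOf_solNear]; exact measurableSet_Icc
  le_measure t a := by
    rw [setOf_solNear, Real.volume_Icc]
    refine ENNReal.ofReal_le_ofReal ?_
    have h1 : (3 + 1 / n)⁻¹ ≤ 1 := inv_le_one_of_one_le₀ (by
      have : 0 < 1 / n := by positivity
      linarith)
    have h2 := Real.exp_pos (n * t)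
    nlinarith
  measure_le t a := by
    rw [setOf_solNear, Real.volume_Icc]
    refine ENNReal.ofReal_le_ofReal ?_
    have h1 : 0 < 1 / n := by positivity
    have h2 := Real.exp_pos (n * t)
    nlinarith

/-- An interval that is long compared with `exp (n t)` is wide. -/
theorem isWide_solNear {n t θ c x₀ ρ : ℝ} (hc : 2 ≤ c) (hρ : Real.exp (n * t) ≤ ρ)
    (hθ : Real.exp (n * t) ≤ θ * ρ) :
    IsWide (volume : Measure ℝ) (solNear n) c t θ (Icc (x₀ - ρ) (x₀ + ρ)) := by
  have hpos := Real.exp_pos (n * t)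
  set r := Real.exp (n * t) with hr
  have hρ0 : 0 < ρ := by linarith
  have hθ0 : 0 < θ := pos_of_mul_pos_left (hpos.trans_le hθ) hρ0.le
  refine ⟨measurableSet_Icc, ?_, ?_, ?_, Icc (x₀ - ρ + r) (x₀ + ρ - r), ?_, ?_, ?_⟩
  · rw [Real.volume_Icc]; exact ENNReal.ofReal_pos.2 (by linarith)
  · rw [Real.volume_Icc]; exact ENNReal.ofReal_lt_top
  · rw [Real.volume_Icc, ← ENNReal.ofReal_mul (by linarith)]
    refine (measure_mono (t := Icc (x₀ - ρ - r) (x₀ + ρ + r)) ?_).trans ?_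
    · rintro b ⟨a, ha, hab⟩
      have := abs_le.1 hab
      constructor <;> linarith [ha.1, ha.2, this.1, this.2]
    · rw [Real.volume_Icc]
      exact ENNReal.ofReal_le_ofReal (by nlinarith)
  · exact Icc_subset_Icc (by linarith) (by linarith)
  · rw [measure_sdiff (Icc_subset_Icc (by linarith) (by linarith))
      measurableSet_Icc.nullMeasurableSet (by rw [Real.volume_Icc]; exact ENNReal.ofReal_ne_top),
      Real.volume_Icc, Real.volume_Icc, ← ENNReal.ofReal_sub _ (by linarith),
      ← ENNReal.ofReal_mul hθ0.le]
    exact ENNReal.ofReal_le_ofReal (by linarith)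
  · intro x hx x' hxx'
    have := abs_le.1 hxx'
    constructor <;> linarith [hx.1, hx.2, this.1, this.2]

theorem exists_le_of_solDist_le {n : ℝ} {p q : ℝ × ℝ × ℝ} {L : ℝ} (h : solDist n p q ≤ L) :
    ∃ l ∈ solLengths n p q, l ≤ L + 1 := by
  obtain ⟨l, hl, hl'⟩ := exists_lt_of_csInf_lt (solLengths_nonempty n p q)
    (show sInf (solLengths n p q) < L + 1 by rw [← solDist_eq_sInf]; linarith)
  exact ⟨l, hl, hl'.le⟩

/-- The linear factor is absorbed by `l ≤ e^l`, leaving `(n + 1)l ≤ (3n + 1)(L + 1)`. The extra `1`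
in `L + 1` allows for the infimum not being attained. -/
theorem solNear_of_le {n t a b l L : ℝ} (hn : 0 < n) (hl : 0 ≤ l) (hL : l ≤ L + 1)
    (h : |a - b| ≤ Real.exp (n * (t + l)) * l) : solNear n (t + (3 + 1 / n) * (L + 1)) a b := by
  refine h.trans ?_
  calc Real.exp (n * (t + l)) * l ≤ Real.exp (n * (t + l)) * Real.exp l := by
        gcongr; linarith [Real.add_one_le_exp l]
    _ ≤ _ := by
        rw [← Real.exp_add, Real.exp_le_exp]
        have e1 : n * (t + (3 + 1 / n) * (L + 1)) = n * t + (3 * n + 1) * (L + 1) := by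
          field_simp
        rw [e1]
        have : (n + 1) * l ≤ (3 * n + 1) * (L + 1) :=
          mul_le_mul (by linarith) hL hl (by linarith)
        linarith

theorem solDist_lower_le {n x x' y z : ℝ} (hn : 0 < n) (h : solNear n z x x') :
    solDist n (x, y, z) (x', y, z) ≤ 3 + 1 / n := by
  refine (solDist_lower n x x' y z).trans ?_
  have h1 : Real.exp (-(n * z)) * |x - x'| ≤ Real.exp (-(n * z)) * Real.exp (n * z) := by
    gcongr; exact h
  rw [← Real.exp_add, neg_add_cancel, Real.exp_zero] at h1
  have : 0 < 1 / n := by positivity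
  linarith

theorem solDist_upper_le {n x y y' z : ℝ} (hn : 0 < n) (h : solNear n (-z) y y') :
    solDist n (x, y, z) (x, y', z) ≤ 3 + 1 / n := by
  refine (solDist_upper n x y y' z).trans ?_
  have h1 : Real.exp (n * z) * |y - y'| ≤ Real.exp (n * z) * Real.exp (n * -z) := by
    gcongr; exact h
  rw [← Real.exp_add, mul_neg, add_neg_cancel, Real.exp_zero] at h1
  have : 0 < 1 / n := by positivity
  linarith

theorem lt_solModel_hMinus {n z y y' : ℝ} (hn : 0 < n) (h : solNear n (-z - 1) y y') :
    (z : EReal) < (solModel n).hMinus y y' := by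
  change (z : EReal) < if y = y' then ⊤ else ((-(Real.log |y - y'| / n) : ℝ) : EReal)
  split_ifs with hyy
  · exact EReal.coe_lt_top z
  · rw [EReal.coe_lt_coe_iff, lt_neg, div_lt_iff₀ hn]
    have hpos : 0 < |y - y'| := abs_pos.2 (sub_ne_zero.2 hyy)
    have h1 := Real.log_le_log hpos h
    rw [Real.log_exp] at h1
    nlinarith

theorem solNear_of_lt_hMinus {n z y y' : ℝ} (hn : 0 < n)
    (h : (z : EReal) < (solModel n).hMinus y y') : solNear n (-z) y y' := by
  change (z : EReal) < if y = y' then ⊤ else ((-(Real.log |y - y'| / n) : ℝ) : EReal) at h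
  split_ifs at h with hyy
  · rw [hyy]; exact (isScale_solNear hn).refl _ _
  · rw [EReal.coe_lt_coe_iff, lt_neg, div_lt_iff₀ hn] at h
    have hpos : 0 < |y - y'| := abs_pos.2 (sub_ne_zero.2 hyy)
    change |y - y'| ≤ _
    rw [← Real.log_le_iff_le_exp hpos]
    linarith

/-- `Sol(n)` has the coarse geometry of a model space. -/
theorem isCoarse_solModel {n : ℝ} (hn : 0 < n) :
    (solModel n).IsCoarse (3 + 1 / n) (solNear n) (solNear n) where
  scaleL := isScale_solNear hn
  scaleU := isScale_solNear hn
  sigmaFiniteL := inferInstanceAs (SigmaFinite (volume : Measure ℝ))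
  sigmaFiniteU := inferInstanceAs (SigmaFinite (volume : Measure ℝ))
  branching_pos := hn
  surj p := ⟨p.1, p.2.1, p.2.2, rfl⟩
  dist_comm := solDist_comm n
  dist_triangle := solDist_triangle n
  dist_vert := solDist_vert n
  dist_lower _ _ _ _ h := solDist_lower_le hn h
  dist_upper _ _ _ _ h := solDist_upper_le hn h
  abs_sub_le x y z x' y' z' := le_csInf (solLengths_nonempty n _ _) fun l hl =>
    (coord_bounds_of_mem_solLengths hn hl).1
  nl_of_dist x y z x' y' z' L h := by
    obtain ⟨l, hl, hlL⟩ := exists_le_of_solDist_le h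
    exact solNear_of_le hn (nonneg_of_mem_solLengths hl) hlL
      (coord_bounds_of_mem_solLengths hn hl).2.1
  nu_of_dist x y z x' y' z' L h := by
    obtain ⟨l, hl, hlL⟩ := exists_le_of_solDist_le h
    exact solNear_of_le hn (nonneg_of_mem_solLengths hl) hlL
      (coord_bounds_of_mem_solLengths hn hl).2.2
  lt_hMinus _ _ _ h := lt_solModel_hMinus hn h
  nu_of_lt _ _ _ h := solNear_of_lt_hMinus hn h
  coord_eq x y z x' y' z' h := by
    have h' : (x, y, z) = (x', y', z') := h
    simp only [Prod.mk.injEq] at h'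
    obtain ⟨rfl, rfl, rfl⟩ := h'
    exact ⟨(isScale_solNear hn).refl _ _, (isScale_solNear hn).refl _ _, rfl⟩
  box θ hθ := by
    refine ⟨max 0 (max (Real.log 2 / n) (Real.log (2 / θ) / n)), ?_⟩
    rintro R hR SX SY hbot htop ⟨x₀, y₀, z₀, rfl, rfl, rfl, rfl⟩
    simp only [max_le_iff, div_le_iff₀ hn] at hR
    obtain ⟨hR0, hR1, hR2⟩ := hR
    have hnR : 0 ≤ R * n := by positivity
    have hc : 2 ≤ 3 + 1 / n := by
      have : 0 < 1 / n := by positivity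
      linarith
    -- The half-width of the base exceeds the scale at the far end of the box by the factor
    -- `e^{3nR/2}/2`. The lower side is `u = z₀`, the upper side `u = -z₀`.
    have key : ∀ u : ℝ, Real.exp (n * (u + R / 2)) ≤ Real.exp (n * u) * (Real.exp (2 * n * R) / 2) ∧
        Real.exp (n * (u + R / 2)) ≤ θ * (Real.exp (n * u) * (Real.exp (2 * n * R) / 2)) := by
      intro u
      have e1 : Real.exp (n * (u + R / 2)) = Real.exp (n * u) * Real.exp (n * R / 2) := by
        rw [← Real.exp_add]; congr 1; ring
      have e2 : Real.exp (2 * n * R) = Real.exp (n * R / 2) * Real.exp (3 / 2 * (n * R)) := by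
        rw [← Real.exp_add]; congr 1; ring
      have h1 : 2 ≤ Real.exp (3 / 2 * (n * R)) := by
        rw [← Real.log_le_iff_le_exp two_pos]; linarith
      have h2 : 2 / θ ≤ Real.exp (3 / 2 * (n * R)) := by
        rw [← Real.log_le_iff_le_exp (by positivity)]; linarith
      rw [div_le_iff₀ hθ] at h2
      rw [e1, e2]
      have hE : 0 < Real.exp (n * u) * Real.exp (n * R / 2) := by positivity
      constructor <;> nlinarith
    refine ⟨by linarith, by linarith, isWide_solNear hc (key z₀).1 (key z₀).2, ?_⟩
    have k1 := key (-z₀)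
    rw [mul_neg] at k1
    have e : -(z₀ - R / 2) = -z₀ + R / 2 := by ring
    exact isWide_solNear hc (by rw [e]; exact k1.1) (by rw [e]; exact k1.2)

/-! ### Base m digits, balls and Haar measure -/

theorem Nat.eq_of_div_pow_mod_eq {m : ℕ} (hm : 2 ≤ m) {a b : ℕ}
    (h : ∀ i, a / m ^ i % m = b / m ^ i % m) : a = b := by
  induction a using Nat.strong_induction_on generalizing b with
  | _ a ih =>
    have h0 := h 0
    simp only [pow_zero, Nat.div_one] at h0
    rcases Nat.eq_zero_or_pos a with rfl | ha
    · by_contra hb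
      have hb0 : b ≠ 0 := fun h => hb h.symm
      -- The leading digit of a nonzero `b` is nonzero.
      have h1 := h (Nat.log m b)
      rw [Nat.zero_div, Nat.zero_mod] at h1
      have h2 : b / m ^ Nat.log m b < m := by
        rw [Nat.div_lt_iff_lt_mul (by positivity), mul_comm, ← pow_succ]
        exact Nat.lt_pow_succ_log_self hm b
      rw [Nat.mod_eq_of_lt h2] at h1
      have h3 : 0 < b / m ^ Nat.log m b :=
        Nat.div_pos (Nat.pow_log_le_self m hb0) (by positivity)
      omega
    · have h1 : a / m = b / m := ih _ (Nat.div_lt_self ha hm) fun i => by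
        have := h (i + 1)
        rwa [pow_succ', ← Nat.div_div_eq_div_mul, ← Nat.div_div_eq_div_mul] at this
      rw [← Nat.div_add_mod a m, ← Nat.div_add_mod b m, h0, h1]

namespace Adic

variable {m : ℕ} {a b d : Adic m} {k k' : ℤ}

theorem Agree.symm (h : Agree k a b) : Agree k b a := fun j hj => (h j hj).symm

theorem Agree.trans (h : Agree k a b) (h' : Agree k b d) : Agree k a d :=
  fun j hj => (h j hj).trans (h' j hj)

theorem Agree.mono (hk : k ≤ k') (h : Agree k a b) : Agree k' a b :=
  fun j hj => h j (hk.trans hj)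

theorem exists_agree (hm : 2 ≤ m) (a b : Adic m) : ∃ k, Agree k a b := by
  refine ⟨((a.1 + b.1 : ℕ) : ℤ), fun j hj => ?_⟩
  have hj0 : 0 ≤ j := le_trans (by positivity) hj
  -- Position `a.1 + b.1` lies beyond all nonzero digits of both, because `k < m ^ k`.
  have h0 : ∀ n : ℕ, n ≤ a.1 + b.1 → n / m ^ j.toNat = 0 := fun n hn => by
    refine Nat.div_eq_of_lt ((Nat.lt_pow_self hm).trans_le ?_)
    exact Nat.pow_le_pow_right (by omega) (by omega)
  simp only [digit, hj0, if_true]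
  rw [h0 _ (by omega), h0 _ (by omega)]

theorem agree_natCast_iff (hm : 2 ≤ m) (p : ℕ) :
    Agree (p : ℤ) a b ↔ a.1 / m ^ p = b.1 / m ^ p := by
  constructor
  · intro h
    refine Nat.eq_of_div_pow_mod_eq hm fun i => ?_
    have := h ((p + i : ℕ) : ℤ) (by push_cast; omega)
    simp only [digit, Nat.cast_nonneg, if_true, Int.toNat_natCast] at this
    rwa [pow_add, ← Nat.div_div_eq_div_mul, ← Nat.div_div_eq_div_mul] at this
  · intro h j hj
    have hj0 : 0 ≤ j := le_trans (by positivity) hj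
    simp only [digit, hj0, if_true]
    obtain ⟨i, hi⟩ : ∃ i, j.toNat = p + i := ⟨j.toNat - p, by omega⟩
    rw [hi, pow_add, ← Nat.div_div_eq_div_mul, ← Nat.div_div_eq_div_mul, h]

theorem agree_neg_natCast_iff (hm : 2 ≤ m) (p : ℕ) :
    Agree (-(p : ℤ)) a b ↔ a.1 = b.1 ∧ ∀ i < p, a.2 i = b.2 i := by
  constructor
  · intro h
    refine ⟨?_, fun i hi => ?_⟩
    · have h0 : Agree ((0 : ℕ) : ℤ) a b := h.mono (by simp)
      simpa using (agree_natCast_iff hm 0).1 h0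
    · have := h (-(i : ℤ) - 1) (by omega)
      have hneg : ¬ (0 ≤ -(i : ℤ) - 1) := by omega
      simp only [digit, hneg, if_false] at this
      have hi' : (-(-(i : ℤ) - 1) - 1).toNat = i := by omega
      rw [hi'] at this
      exact Fin.ext this
  · rintro ⟨h1, h2⟩ j hj
    by_cases hj0 : 0 ≤ j
    · simp only [digit, hj0, if_true, h1]
    · simp only [digit, hj0, if_false]
      rw [h2 _ (by omega)]

theorem setOf_agree_natCast (hm : 2 ≤ m) (p : ℕ) (a : Adic m) :
    {b | Agree (p : ℤ) a b} =
      (Finset.Ico (a.1 / m ^ p * m ^ p) (a.1 / m ^ p * m ^ p + m ^ p) : Set ℕ) ×ˢ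
        (univ : Set (ℕ → Fin m)) := by
  have hpos : 0 < m ^ p := by positivity
  ext ⟨b, s⟩
  simp only [mem_ofPred_eq, agree_natCast_iff hm, mem_prod, Finset.coe_Ico, mem_Ico, mem_univ,
    and_true]
  constructor
  · intro h
    rw [h]
    exact ⟨Nat.div_mul_le_self b _, Nat.lt_div_mul_add hpos⟩
  · rintro ⟨h1, h2⟩
    symm
    rw [Nat.div_eq_iff hpos]
    constructor
    · exact h1
    · omega

theorem setOf_agree_neg_natCast (hm : 2 ≤ m) (p : ℕ) (a : Adic m) :
    {b | Agree (-(p : ℤ)) a b} =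
      ({a.1} : Set ℕ) ×ˢ Set.pi (Finset.range p : Set ℕ) (fun i => ({a.2 i} : Set (Fin m))) := by
  ext ⟨b, s⟩
  simp only [mem_ofPred_eq, agree_neg_natCast_iff hm, mem_prod, mem_singleton_iff, Set.mem_pi,
    Finset.coe_range, mem_Iio]
  constructor
  · rintro ⟨h1, h2⟩
    exact ⟨h1.symm, fun i hi => (h2 i hi).symm⟩
  · rintro ⟨h1, h2⟩
    exact ⟨h1.symm, fun i hi => (h2 i hi).symm⟩

theorem measurableSet_agree (hm : 2 ≤ m) (k : ℤ) (a : Adic m) :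
    MeasurableSet {b | Agree k a b} := by
  obtain ⟨p, rfl | rfl⟩ := k.eq_nat_or_neg
  · rw [setOf_agree_natCast hm]
    exact (MeasurableSet.of_discrete).prod MeasurableSet.univ
  · rw [setOf_agree_neg_natCast hm]
    exact (MeasurableSet.of_discrete).prod
      (MeasurableSet.pi (Finset.countable_toSet _) fun _ _ => MeasurableSet.of_discrete)

/-- For `k ≥ 0` a ball is a block of `m^k` integer parts with free tails; for `k = -p` the integer
part and `p` fractional digits are fixed. Both give `m^k` exactly. -/
theorem measure_agree (hm : 2 ≤ m) (k : ℤ) (a : Adic m) :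
    adicMeasure m {b | Agree k a b} = ENNReal.ofReal (Real.exp (Real.log m * k)) := by
  have hm0 : (0 : ℝ) < m := by positivity
  have : NeZero m := ⟨by omega⟩
  obtain ⟨p, rfl | rfl⟩ := k.eq_nat_or_neg
  · rw [setOf_agree_natCast hm, adicMeasure, Measure.prod_prod, measure_univ, mul_one,
      Measure.count_apply_finset, Nat.card_Ico, add_tsub_cancel_left, Int.cast_natCast, mul_comm,
      Real.exp_nat_mul, Real.exp_log hm0, ← Nat.cast_pow, ENNReal.ofReal_natCast]
  · rw [setOf_agree_neg_natCast hm, adicMeasure, Measure.prod_prod, Measure.count_singleton,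
      one_mul, Measure.infinitePi_pi _ fun _ _ => MeasurableSet.of_discrete]
    have h1 : ∀ i ∈ Finset.range p, ProbabilityTheory.uniformOn (univ : Set (Fin m)) {a.2 i} =
        ENNReal.ofReal ((m : ℝ)⁻¹) := fun i _ => by
      rw [ProbabilityTheory.uniformOn_univ, Measure.count_singleton, Fintype.card_fin, one_div,
        ENNReal.ofReal_inv_of_pos hm0, ENNReal.ofReal_natCast]
    rw [Finset.prod_congr rfl h1, Finset.prod_const, Finset.card_range,
      ← ENNReal.ofReal_pow (by positivity)]
    congr 1
    push_cast
    rw [mul_neg, Real.exp_neg, mul_comm, Real.exp_nat_mul, Real.exp_log hm0, inv_pow]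

end Adic

/-! ### Scales on the adic boundary -/

/-- Closeness at scale `exp t` on the boundary of the Diestel-Leader graph. -/
def adicNear (m : ℕ) (t : ℝ) (a b : Adic m) : Prop := Adic.Agree ⌊t⌋ a b

/-- Agreement at a given scale is already transitive, so the constant `m` is needed only to absorb
the rounding of `t` to `⌊t⌋`. -/
theorem isScale_adicNear {m : ℕ} (hm : 2 ≤ m) :
    IsScale (adicMeasure m) (Real.log m) m (adicNear m) where
  one_le := by exact_mod_cast (by omega : 1 ≤ m)
  refl t a := fun _ _ => rfl
  symm h := h.symm
  mono h hab := hab.mono (Int.floor_le_floor h)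
  trans h h' := (h.trans h').mono (Int.floor_le_floor (by simp))
  measurable t a := Adic.measurableSet_agree hm _ a
  le_measure t a := by
    have hm0 : (0 : ℝ) < m := by positivity
    have hlog : 0 < Real.log m := Real.log_pos (by exact_mod_cast hm)
    refine le_trans (ENNReal.ofReal_le_ofReal ?_) (Adic.measure_agree hm ⌊t⌋ a).ge
    have h1 : (m : ℝ)⁻¹ = Real.exp (-Real.log m) := by rw [Real.exp_neg, Real.exp_log hm0]
    rw [h1, ← Real.exp_add, Real.exp_le_exp]
    nlinarith [Int.lt_floor_add_one t]
  measure_le t a := by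
    have hm1 : (1 : ℝ) ≤ m := by exact_mod_cast (by omega : 1 ≤ m)
    have hlog : 0 < Real.log m := Real.log_pos (by exact_mod_cast hm)
    refine le_trans (Adic.measure_agree hm ⌊t⌋ a).le (ENNReal.ofReal_le_ofReal ?_)
    calc Real.exp (Real.log m * ⌊t⌋) ≤ Real.exp (Real.log m * t) := by
          gcongr; exact Int.floor_le t
      _ ≤ _ := le_mul_of_one_le_left (Real.exp_nonneg _) hm1

/-- A ball of an ultrametric has no edge at its own scale: it equals its thickening and its
interior. -/
theorem isWide_setOf_adicNear {m : ℕ} (hm : 2 ≤ m) {t θ : ℝ} (x₀ : Adic m) :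
    IsWide (adicMeasure m) (adicNear m) m t θ {x | adicNear m t x₀ x} where
  measurable := (isScale_adicNear hm).measurable t x₀
  pos := by
    rw [show {x | adicNear m t x₀ x} = {x | Adic.Agree ⌊t⌋ x₀ x} from rfl,
      Adic.measure_agree hm]
    exact ENNReal.ofReal_pos.2 (Real.exp_pos _)
  lt_top := ((isScale_adicNear hm).measure_le t x₀).trans_lt ENNReal.ofReal_lt_top
  thick_le := by
    have h1 : thick (adicNear m) t {x | adicNear m t x₀ x} ⊆ {x | adicNear m t x₀ x} :=
      fun b ⟨a, ha, hab⟩ => Adic.Agree.trans ha hab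
    refine (measure_mono h1).trans (le_mul_of_one_le_left' ?_)
    rw [ENNReal.ofReal_natCast]
    exact_mod_cast (by omega : 1 ≤ m)
  interior := ⟨_, le_rfl, by simp, fun x hx x' h => Adic.Agree.trans hx h⟩

/-! ### Paths in the Diestel-Leader graph -/

theorem TreePt.mk_eq_mk_iff {m : ℕ} {x x' : Adic m} {s s' : ℝ} :
    TreePt.mk x s = TreePt.mk x' s' ↔ s = s' ∧ Adic.Agree ⌊s⌋ x x' := Quotient.eq

namespace DL

variable {m : ℕ}

theorem pt_eq_pt_iff {x x' y y' : Adic m} {z z' : ℝ} :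
    DL.pt x y z = DL.pt x' y' z' ↔
      z = z' ∧ Adic.Agree ⌊z⌋ x x' ∧ Adic.Agree ⌊-z⌋ y y' := by
  have h : DL.pt x y z = DL.pt x' y' z' ↔
      (TreePt.mk x z, TreePt.mk y (-z)) = (TreePt.mk x' z', TreePt.mk y' (-z')) := Subtype.ext_iff
  rw [h, Prod.mk.injEq, TreePt.mk_eq_mk_iff, TreePt.mk_eq_mk_iff]
  constructor
  · rintro ⟨⟨h1, h2⟩, -, h3⟩
    exact ⟨h1, h2, h3⟩
  · rintro ⟨h1, h2, h3⟩
    exact ⟨⟨h1, h2⟩, by rw [h1], h3⟩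

theorem exists_pt_eq (p : DL m) : ∃ x y z, DL.pt x y z = p := by
  obtain ⟨⟨T, T'⟩, h⟩ := p
  induction T using Quotient.inductionOn with
  | _ u =>
  induction T' using Quotient.inductionOn with
  | _ v =>
    obtain ⟨x, s⟩ := u
    obtain ⟨y, s'⟩ := v
    have hs : s + s' = 0 := h
    obtain rfl : s' = -s := by linarith
    exact ⟨x, y, s, rfl⟩

theorem PathLength.nonneg {p q : DL m} {l : ℝ} (h : PathLength p q l) : 0 ≤ l := by
  induction h with
  | nil p => exact le_rfl
  | cons x y s t q l _ ih => positivity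

theorem PathLength.append {p q r : DL m} {l l' : ℝ} (h : PathLength p q l)
    (h' : PathLength q r l') : PathLength p r (l + l') := by
  induction h with
  | nil p => rwa [zero_add]
  | cons x y s t q l _ ih => rw [add_assoc]; exact PathLength.cons x y s t r _ (ih h')

theorem pathLength_vert (x y : Adic m) (s t : ℝ) :
    PathLength (DL.pt x y s) (DL.pt x y t) |s - t| := by
  have := PathLength.cons x y s t _ 0 (PathLength.nil (DL.pt x y t))
  rwa [add_zero] at this

theorem PathLength.symm {p q : DL m} {l : ℝ} (h : PathLength p q l) : PathLength q p l := by
  induction h with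
  | nil p => exact PathLength.nil p
  | cons x y s t q l _ ih =>
    rw [add_comm, abs_sub_comm]
    exact ih.append (pathLength_vert x y t s)

/-- Move to a height `-k'` where the geodesics over `y` and `y'` coincide and switch `y`, then to a
height `k` where those over `x` and `x'` coincide and switch `x`. -/
theorem exists_pathLength (hm : 2 ≤ m) (p q : DL m) : ∃ l, PathLength p q l := by
  obtain ⟨x, y, z, rfl⟩ := exists_pt_eq p
  obtain ⟨x', y', z', rfl⟩ := exists_pt_eq q
  obtain ⟨k, hk⟩ := Adic.exists_agree hm x x'
  obtain ⟨k', hk'⟩ := Adic.exists_agree hm y y'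
  have h1 : DL.pt x y (-(k' : ℝ)) = DL.pt x y' (-(k' : ℝ)) :=
    pt_eq_pt_iff.2 ⟨rfl, fun _ _ => rfl, by rwa [neg_neg, Int.floor_intCast]⟩
  have h2 : DL.pt x y' (k : ℝ) = DL.pt x' y' (k : ℝ) :=
    pt_eq_pt_iff.2 ⟨rfl, by rwa [Int.floor_intCast], fun _ _ => rfl⟩
  have p1 := pathLength_vert x y z (-(k' : ℝ))
  have p2 := pathLength_vert x y' (-(k' : ℝ)) k
  have p3 := pathLength_vert x' y' k z'
  rw [h1] at p1
  rw [h2] at p2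
  exact ⟨_, (p1.append p2).append p3⟩

/-- A path of length `l` stays between heights `z - l` and `z + l`, so it cannot change the digits
of `x` above `z + l`, nor those of `y` above `-z + l`. -/
theorem PathLength.coord_bounds {p q : DL m} {l : ℝ} (h : PathLength p q l) :
    ∀ x y z x' y' z', p = DL.pt x y z → q = DL.pt x' y' z' →
      |z - z'| ≤ l ∧ Adic.Agree ⌊z + l⌋ x x' ∧ Adic.Agree ⌊-z + l⌋ y y' := by
  induction h with
  | nil p =>
    rintro x y z x' y' z' rfl h
    obtain ⟨rfl, h1, h2⟩ := pt_eq_pt_iff.1 h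
    simpa using ⟨h1, h2⟩
  | cons u v s t q l hp ih =>
    rintro x y z x' y' z' h rfl
    obtain ⟨rfl, h1, h2⟩ := pt_eq_pt_iff.1 h
    obtain ⟨h3, h4, h5⟩ := ih u v t x' y' z' rfl rfl
    have hl := hp.nonneg
    have ha := abs_le.1 (le_refl |s - t|)
    refine ⟨?_, ?_, ?_⟩
    · calc |s - z'| ≤ |s - t| + |t - z'| := abs_sub_le _ _ _
        _ ≤ _ := by linarith
    · exact (h1.symm.mono (Int.floor_le_floor (by linarith [abs_nonneg (s - t)]))).trans
        (h4.mono (Int.floor_le_floor (by linarith [ha.1])))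
    · exact (h2.symm.mono (Int.floor_le_floor (by linarith [abs_nonneg (s - t)]))).trans
        (h5.mono (Int.floor_le_floor (by linarith [ha.2])))

theorem dist_le {p q : DL m} {l : ℝ} (h : PathLength p q l) : DL.dist p q ≤ l :=
  csInf_le ⟨0, fun _ h => h.nonneg⟩ h

theorem exists_pathLength_lt (hm : 2 ≤ m) (p q : DL m) {L : ℝ} (h : DL.dist p q < L) :
    ∃ l, PathLength p q l ∧ l < L :=
  exists_lt_of_csInf_lt (exists_pathLength hm p q) h

theorem dist_comm (p q : DL m) : DL.dist p q = DL.dist q p := by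
  rw [DL.dist, DL.dist]
  congr 1
  ext l
  exact ⟨PathLength.symm, PathLength.symm⟩

theorem dist_triangle (hm : 2 ≤ m) (p q r : DL m) :
    DL.dist p r ≤ DL.dist p q + DL.dist q r := by
  refine le_of_forall_pos_le_add fun ε hε => ?_
  obtain ⟨l, hl, hl'⟩ := exists_pathLength_lt hm p q (lt_add_of_pos_right _ (half_pos hε))
  obtain ⟨k, hk, hk'⟩ := exists_pathLength_lt hm q r (lt_add_of_pos_right _ (half_pos hε))
  linarith [dist_le (hl.append hk)]

theorem dist_self_le (p : DL m) : DL.dist p p ≤ 0 := dist_le (PathLength.nil p)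

theorem coord_bounds_of_dist_le (hm : 2 ≤ m) {x y x' y' : Adic m} {z z' L : ℝ}
    (h : DL.dist (DL.pt x y z) (DL.pt x' y' z') ≤ L) :
    adicNear m (z + m * (L + 1)) x x' ∧ adicNear m (-z + m * (L + 1)) y y' := by
  obtain ⟨l, hl, hlL⟩ := exists_pathLength_lt hm _ _ (h.trans_lt (lt_add_one L))
  obtain ⟨-, h1, h2⟩ := hl.coord_bounds _ _ _ _ _ _ rfl rfl
  have hm1 : (1 : ℝ) ≤ m := by exact_mod_cast (by omega : 1 ≤ m)
  have hlm : l ≤ m * (L + 1) := hlL.le.trans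
    (le_mul_of_one_le_left (hl.nonneg.trans hlL.le) hm1)
  exact ⟨h1.mono (Int.floor_le_floor (by linarith)), h2.mono (Int.floor_le_floor (by linarith))⟩

end DL

/-! ### The axioms for the Diestel-Leader graph -/

theorem lt_dlModel_hMinus {m : ℕ} {z : ℝ} {y y' : Adic m} (h : adicNear m (-z - 1) y y') :
    (z : EReal) < (dlModel m).hMinus y y' := by
  change (z : EReal) < -Adic.meet y y'
  rw [EReal.lt_neg_comm, ← EReal.coe_neg]
  refine (iInf₂_le (⌊-z - 1⌋) h).trans_lt ?_
  rw [EReal.coe_lt_coe_iff]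
  linarith [Int.floor_le (-z - 1)]

theorem adicNear_of_lt_hMinus {m : ℕ} {z : ℝ} {y y' : Adic m}
    (h : (z : EReal) < (dlModel m).hMinus y y') : adicNear m (-z) y y' := by
  change (z : EReal) < -Adic.meet y y' at h
  rw [EReal.lt_neg_comm, ← EReal.coe_neg] at h
  obtain ⟨k, hk⟩ := iInf_lt_iff.1 h
  obtain ⟨hk, hk'⟩ := iInf_lt_iff.1 hk
  rw [EReal.coe_lt_coe_iff] at hk'
  exact hk.mono (Int.le_floor.2 hk'.le)

theorem sigmaFinite_adicMeasure {m : ℕ} (hm : 2 ≤ m) : SigmaFinite (adicMeasure m) := by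
  have : NeZero m := ⟨by omega⟩
  unfold adicMeasure
  infer_instance

/-- `DL(m, m)` has the coarse geometry of a model space. -/
theorem isCoarse_dlModel {m : ℕ} (hm : 2 ≤ m) :
    (dlModel m).IsCoarse m (adicNear m) (adicNear m) where
  scaleL := isScale_adicNear hm
  scaleU := isScale_adicNear hm
  sigmaFiniteL := sigmaFinite_adicMeasure hm
  sigmaFiniteU := sigmaFinite_adicMeasure hm
  branching_pos := Real.log_pos (by exact_mod_cast hm)
  surj := DL.exists_pt_eq
  dist_comm := DL.dist_comm
  dist_triangle := DL.dist_triangle hm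
  dist_vert x y z z' := DL.dist_le (DL.pathLength_vert x y z z')
  dist_lower x x' y z h := by
    have h1 : DL.pt x y z = DL.pt x' y z := DL.pt_eq_pt_iff.2 ⟨rfl, h, fun _ _ => rfl⟩
    change DL.dist (DL.pt x y z) (DL.pt x' y z) ≤ m
    rw [h1]
    exact (DL.dist_self_le _).trans (Nat.cast_nonneg m)
  dist_upper x y y' z h := by
    have h1 : DL.pt x y z = DL.pt x y' z := DL.pt_eq_pt_iff.2 ⟨rfl, fun _ _ => rfl, h⟩
    change DL.dist (DL.pt x y z) (DL.pt x y' z) ≤ m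
    rw [h1]
    exact (DL.dist_self_le _).trans (Nat.cast_nonneg m)
  abs_sub_le x y z x' y' z' := le_csInf (DL.exists_pathLength hm _ _) fun _ hl =>
    (DL.PathLength.coord_bounds hl x y z x' y' z' rfl rfl).1
  nl_of_dist _ _ _ _ _ _ _ h := (DL.coord_bounds_of_dist_le hm h).1
  nu_of_dist _ _ _ _ _ _ _ h := (DL.coord_bounds_of_dist_le hm h).2
  lt_hMinus _ _ _ h := lt_dlModel_hMinus h
  nu_of_lt _ _ _ h := adicNear_of_lt_hMinus h
  coord_eq _ _ _ _ _ _ h := by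
    obtain ⟨h1, h2, h3⟩ := DL.pt_eq_pt_iff.1 h
    exact ⟨h2, h3, h1⟩
  box θ _ := by
    refine ⟨0, ?_⟩
    rintro R - SX SY hbot htop ⟨x₀, y₀, k, l, -, rfl, rfl, rfl, rfl⟩
    -- The base of a box is a ball at exactly the scale of its top, or of its bottom for the upper
    -- side, so no lower bound on `R` is needed.
    have hset : ∀ (t : ℝ) (x₀ : Adic m),
        {x | TreePt.mk x t = TreePt.mk x₀ t} = {x | adicNear m t x₀ x} := fun t x₀ => by
      ext x
      simp only [mem_ofPred_eq, TreePt.mk_eq_mk_iff, true_and, adicNear]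
      exact ⟨Adic.Agree.symm, Adic.Agree.symm⟩
    refine ⟨by linarith, by linarith, ?_, ?_⟩
    · rw [hset]; exact isWide_setOf_adicNear hm x₀
    · rw [hset]; exact isWide_setOf_adicNear hm y₀

/-! ### Conclusion -/

theorem proposition4 (X X' : ModelSpace) (hX : ModelPair X X')
    (κ C K : ℝ) (hκ : 1 ≤ κ) (hC : 0 ≤ C) (hK : 0 < K) :
    (X = X' → X.branching / X'.branching = 1) ∧
    -- the constants `β ≪ β' ≪ β'' ≪ 1`
    ∃ b'' : ℝ, 0 < b'' ∧ ∀ β'' : ℝ, 0 < β'' → β'' < b'' →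
    ∃ b' : ℝ, 0 < b' ∧ ∀ β' : ℝ, 0 < β' → β' < b' →
    ∃ b : ℝ, 0 < b ∧ ∀ β : ℝ, 0 < β → β < b →
    ∃ (δ₀ : ℝ) (ε' c : ℝ → ℝ → ℝ), 0 < δ₀ ∧
      Tendsto (fun p : ℝ × ℝ => ε' p.1 p.2) (𝓝[>] 0 ×ˢ 𝓝[>] 0) (𝓝 0) ∧
      Tendsto (fun p : ℝ × ℝ => c p.1 p.2) (𝓝[>] 0 ×ˢ 𝓝[>] 0) (𝓝 0) ∧
    ∀ ε θ : ℝ, 0 < ε → ε < δ₀ → 0 < θ → θ < δ₀ →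
    ∀ ρ₁ : ℝ, 0 < ρ₁ →
    ∃ R₀ : ℝ, 0 < R₀ ∧ ∀ R : ℝ, R₀ ≤ R →
    -- the box, the map, the almost product structure
    ∀ (SX : Set X.Lower) (SY : Set X.Upper) (hbot htop : ℝ), X.IsBox R SX SY hbot htop →
    ∀ φ : X.Pt → X'.Pt, X.IsQuasiIsometry X' κ C φ →
    ∀ (E₁ : Set X.Lower) (E₂ : Set X.Upper) (f : X.Lower → X'.Lower) (g : X.Upper → X'.Upper)
      (q : ℝ → ℝ), X.IsAlmostProduct X' R (K * ε) θ SX SY hbot htop φ E₁ E₂ f g q →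
    ∀ U' : Set X.Pt, U' ⊆ X.productSet E₁ E₂ hbot htop → X.IsMeasurable U' →
      ENNReal.ofReal (1 - 128 * Real.sqrt θ) * X.vol (X.productSet E₁ E₂ hbot htop) ≤ X.vol U' →
    ∃ E' : Set X.Lower, E' ⊆ SX ∧ E'.Nonempty ∧
      X.lowerMeasure (SX \ E') ≤ ENNReal.ofReal (c ε θ) * X.lowerMeasure SX ∧
    -- the horocycle `H` and the set `S`
    ∀ x₀ ∈ SX, ∀ h₀ : ℝ, 4 * κ ^ 2 * β'' * R < htop - h₀ → 4 * κ ^ 2 * β'' * R < h₀ - hbot →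
      (X.piMinus ρ₁ (X.yHorocycle x₀ h₀) ∩ E').Nonempty →
    ∀ a : ℝ, a = h₀ - β'' * R ∨ a = h₀ →
    ∀ S : Set X.Pt,
      S = X.slab (X.piMinus ρ₁ (X.yHorocycle x₀ h₀)) SY a (a + β'' * R) ∩ U' →
    ∀ zbot ztop : ℝ, hbot < zbot → zbot < ztop → ztop < htop →
      4 * β * R ≤ |ztop - zbot| → |ztop - zbot| ≤ β' * R →
      4 * κ ^ 2 * β'' * R < |htop - ztop| → 4 * κ ^ 2 * β'' * R < |zbot - hbot| →
      0 < X'.upperMeasure (X'.coarsenUpper (q zbot) (g '' (X.yCoords SY S ∩ E₂))) ∧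
      X'.upperMeasure (X'.coarsenUpper (q zbot) (g '' (X.yCoords SY S ∩ E₂))) < ⊤ ∧
      ∀ z ∈ Icc zbot ztop,
        |q z - (X.branching / X'.branching * z - 1 / X'.branching *
          Real.log ((X'.upperMeasure (X'.coarsenUpper (q zbot)
            (g '' (X.yCoords SY S ∩ E₂)))).toReal / (X.upperMeasure SY).toReal))|
          ≤ ε' ε θ * R := by
  have key : ∃ (c c' : ℝ) (NL : ℝ → X.Lower → X.Lower → Prop)
      (NU : ℝ → X.Upper → X.Upper → Prop) (NL' : ℝ → X'.Lower → X'.Lower → Prop)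
      (NU' : ℝ → X'.Upper → X'.Upper → Prop),
      X.IsCoarse c NL NU ∧ X'.IsCoarse c' NL' NU' := by
    cases hX with
    | sol n n' hn hn' => exact ⟨_, _, _, _, _, _, isCoarse_solModel hn, isCoarse_solModel hn'⟩
    | dl m m' hm hm' => exact ⟨_, _, _, _, _, _, isCoarse_dlModel hm, isCoarse_dlModel hm'⟩
  obtain ⟨c, c', NL, NU, NL', NU', H, H'⟩ := key
  refine ⟨?_, H.height_affine H' hκ hC hK⟩
  rintro rfl
  exact div_self H.branching_pos.ne'
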